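/- Let $k$ be a field of characteristic $0$, let $r\ge 0$, and let $A\in M_r(k)$ be an anti-symmetric matrix ($A^T=-A$). Let $\mathfrak{so}(A)=\{M\in M_r(k)\mid MA=-AM^T\}$, a Lie subalgebra of $\mathfrak{gl}_r(k)$ with bracket $\{M,N\}=MN-NM$, and let $X_1,\dots,X_d$ be a $k$-basis of $\mathfrak{so}(A)$. Let $\mathrm{UM}(A)$ be the associative unital $k$-algebra generated by $x_0,\dots,x_r,\,y_1,\dots,y_r,\,X_1,\dots,X_d$ subject to the relations (where $[u,v]=uv-vu$) \begin{align*} &[x_0,g]=0 && \text{for every generator } g,\\ &[x_i,x_j]=A_{ij}x_0,\qquad [y_i,y_j]=\tfrac13A_{ij}x_0^3,\qquad [x_i,y_j]=0 && 1\le i,j\le r,\\ &[x_i,M]=\sum_{l=1}^r M_{il}x_l,\qquad [y_i,M]=\sum_{l=1}^r M_{il}y_l && 1\le i\le r,\ M\in\{X_1,\dots,X_d\},\\ &[X_m,X_n]=\sum_{l=1}^d\alpha_l X_l && \text{where } \{X_m,X_n\}=\sum_{l=1}^d\alpha_l X_l \text{ in } \mathfrak{so}(A). \end{align*} Then the following hold.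 (a) There is a Hopf algebra structure on the $k$-algebra $\mathrm{UM}(A)$ such that $x_0,\dots,x_r$ and all elements of $\mathfrak{so}(A)$ (mapped to $\mathrm{UM}(A)$ by the linear map sending each basis element to the corresponding generator) are primitive, i.e. $\Delta u=u\otimes1+1\otimes u$, and such that for $1\le i\le r$ $$\Delta y_i=y_i\otimes 1+1\otimes y_i+x_0\otimes x_i-x_i\otimes x_0,\qquad \varepsilon(y_i)=0,\qquad S(y_i)=-y_i;$$ and with this structure $\mathrm{UM}(A)$ is a connected Hopf algebra, i.e. its coradical (the sum of its simple subcoalgebras) is $k\cdot1$. (b) The generators, ordered as $x_0<x_1<\dots<x_r<X_1<\dots<X_d<y_1<\dots<y_r$, form a PBW generating set of $\mathrm{UM}(A)$: the ordered monomials $$x_0^{a_0}\cdots x_r^{a_r}\,X_1^{b_1}\cdots X_d^{b_d}\,y_1^{c_1}\cdots y_r^{c_r}\qquad(a_i,b_j,c_l\in\mathbb N)$$ form a $k$-basis of $\mathrm{UM}(A)$. (c) $\operatorname{GKdim}\mathrm{UM}(A)=2r+1+\dim_k\mathfrak{so}(A)$, where $\operatorname{GKdim}$ is the Gelfand-Kirillov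 dimension. -/

import Mathlib

open scoped TensorProduct

noncomputable section

/-! ### General notions -/

/-- The Gelfand-Kirillov dimension of a `k`-algebra `B`: the supremum, over all finite-dimensional
subspaces `V` of `B`, of `limsup_n log_n (dim (∑_{i ≤ n} V ^ i))`. -/
def GKdim (k B : Type*) [Field k] [Ring B] [Algebra k B] : EReal :=
  ⨆ V : {V : Submodule k B // FiniteDimensional k V},
    Filter.limsup
      (fun n : ℕ =>
        ((Real.log (Module.finrank k ↥(⨆ i ∈ Finset.range (n + 1), V.1 ^ i)) / Real.log n : ℝ) :
          EReal))
      Filter.atTop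

/-- `z_1 < z_2 < ... < z_n` is a PBW generating set of `B`: the ordered monomials
`z_1 ^ e_1 * z_2 ^ e_2 * ... * z_n ^ e_n`, indexed by `e : Fin n → ℕ`, form a `k`-basis of `B`. -/
def IsPBWGeneratingSet (k : Type*) {B : Type*} [Field k] [Ring B] [Algebra k B] {n : ℕ}
    (z : Fin n → B) : Prop :=
  LinearIndependent k (fun e : Fin n → ℕ => (List.ofFn fun i => z i ^ e i).prod) ∧
    Submodule.span k (Set.range fun e : Fin n → ℕ => (List.ofFn fun i => z i ^ e i).prod) = ⊤

section Coalgebra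

variable (k : Type*) {C : Type*} [Field k] [AddCommGroup C] [Module k C] [Coalgebra k C]

/-- A subspace `D` of a coalgebra with `Δ(D) ⊆ D ⊗ D`. -/
def IsSubcoalgebra (D : Submodule k C) : Prop :=
  ∀ c ∈ D, Coalgebra.comul (R := k) c ∈ LinearMap.range (TensorProduct.mapIncl D D)

/-- A nonzero subcoalgebra whose only subcoalgebras are `0` and itself. -/
def IsSimpleSubcoalgebra (D : Submodule k C) : Prop :=
  IsSubcoalgebra k D ∧ D ≠ ⊥ ∧
    ∀ E : Submodule k C, IsSubcoalgebra k E → E ≤ D → E = ⊥ ∨ E = D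

variable (C) in
/-- The coradical: the sum of all simple subcoalgebras. -/
def coradical : Submodule k C :=
  sSup {D : Submodule k C | IsSimpleSubcoalgebra k D}

end Coalgebra

/-- A Hopf algebra is connected if its coradical is `k · 1`. -/
def IsConnectedHopf (k H : Type*) [Field k] [Ring H] [HopfAlgebra k H] : Prop :=
  coradical k H = Submodule.span k {(1 : H)}

/-- `u` is primitive: `Δ u = u ⊗ 1 + 1 ⊗ u`. -/
def IsPrimitiveElt (k : Type*) {H : Type*} [Field k] [Ring H] [HopfAlgebra k H] (u : H) : Prop :=
  Coalgebra.comul (R := k) u = u ⊗ₜ[k] 1 + 1 ⊗ₜ[k] u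

/-- The Hopf structure on an element `v` attached to elements `a` and `u`:
`Δ v = v ⊗ 1 + 1 ⊗ v + a ⊗ u - u ⊗ a`, `ε(v) = 0` and `S(v) = -v`. -/
structure IsWedgeElt (k : Type*) {H : Type*} [Field k] [Ring H] [HopfAlgebra k H]
    (a u v : H) : Prop where
  comul_eq : Coalgebra.comul (R := k) v = v ⊗ₜ[k] 1 + 1 ⊗ₜ[k] v + a ⊗ₜ[k] u - u ⊗ₜ[k] a
  counit_eq : Coalgebra.counit (R := k) v = 0
  antipode_eq : HopfAlgebra.antipode k v = -v

/-! ### The Lie algebra `so(A)` -/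

section so

attribute [local instance] LieRing.ofAssociativeRing

/-- The Lie subalgebra `so(A) = {M | M A = - A Mᵀ}` of `gl_r(k)`. -/
def soLie {k : Type*} [Field k] {r : ℕ} (A : Matrix (Fin r) (Fin r) k) :
    LieSubalgebra k (Matrix (Fin r) (Fin r) k) where
  carrier := {M | M * A = -(A * M.transpose)}
  add_mem' := by
    intro M N hM hN
    simp only [Set.mem_ofPred_eq] at hM hN ⊢
    rw [add_mul, hM, hN, Matrix.transpose_add, mul_add, neg_add]
  zero_mem' := by simp
  smul_mem' := by
    intro c M hM
    simp only [Set.mem_ofPred_eq] at hM ⊢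
    rw [Matrix.smul_mul, hM, Matrix.transpose_smul, Matrix.mul_smul, smul_neg]
  lie_mem' := by
    intro M N hM hN
    simp only [Set.mem_ofPred_eq] at hM hN ⊢
    change M * A = _ at hM
    change N * A = _ at hN
    rw [Ring.lie_def, sub_mul, mul_assoc, hN, mul_assoc, hM, mul_neg, mul_neg, ← mul_assoc,
      ← mul_assoc, hM, hN, Matrix.transpose_sub, Matrix.transpose_mul, Matrix.transpose_mul,
      mul_sub]
    simp only [neg_mul, neg_neg, mul_assoc, neg_sub]

end so

/-! ### The algebra `UM(A)` -/

/-- The generators `x_0, ..., x_r`, `X_1, ..., X_d`, `y_1, ..., y_r`. -/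
inductive UMGen (r d : ℕ) : Type
  | x (i : Fin (r + 1))
  | X (j : Fin d)
  | y (i : Fin r)

section UM

variable {k : Type*} [Field k] {r d : ℕ} (A : Matrix (Fin r) (Fin r) k)
  (b : Module.Basis (Fin d) k (soLie A))

/-- The commutator `[u, v] = u v - v u` in the free algebra on the generators. -/
def freeComm (u v : FreeAlgebra k (UMGen r d)) : FreeAlgebra k (UMGen r d) := u * v - v * u

/-- The defining relations of `UM(A)` with respect to the basis `b = (X_1, ..., X_d)` of `so(A)`;
for `1 ≤ i ≤ r` the generator `x_i` is `UMGen.x i.succ` and `x_0` is `UMGen.x 0`. -/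
inductive UMRel : FreeAlgebra k (UMGen r d) → FreeAlgebra k (UMGen r d) → Prop
  | x0 (g : UMGen r d) :
      UMRel (freeComm (FreeAlgebra.ι k (UMGen.x 0)) (FreeAlgebra.ι k g)) 0
  | xx (i j : Fin r) :
      UMRel (freeComm (FreeAlgebra.ι k (UMGen.x i.succ)) (FreeAlgebra.ι k (UMGen.x j.succ)))
        (A i j • FreeAlgebra.ι k (UMGen.x 0))
  | yy (i j : Fin r) :
      UMRel (freeComm (FreeAlgebra.ι k (UMGen.y i)) (FreeAlgebra.ι k (UMGen.y j)))
        ((1 / 3 * A i j : k) • FreeAlgebra.ι k (UMGen.x 0) ^ 3)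
  | xy (i j : Fin r) :
      UMRel (freeComm (FreeAlgebra.ι k (UMGen.x i.succ)) (FreeAlgebra.ι k (UMGen.y j))) 0
  | xM (i : Fin r) (m : Fin d) :
      UMRel (freeComm (FreeAlgebra.ι k (UMGen.x i.succ)) (FreeAlgebra.ι k (UMGen.X m)))
        (∑ l : Fin r, (b m).1 i l • FreeAlgebra.ι k (UMGen.x l.succ))
  | yM (i : Fin r) (m : Fin d) :
      UMRel (freeComm (FreeAlgebra.ι k (UMGen.y i)) (FreeAlgebra.ι k (UMGen.X m)))
        (∑ l : Fin r, (b m).1 i l • FreeAlgebra.ι k (UMGen.y l))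
  | MN (m n : Fin d) :
      UMRel (freeComm (FreeAlgebra.ι k (UMGen.X m)) (FreeAlgebra.ι k (UMGen.X n)))
        (∑ l : Fin d, b.repr ⁅b m, b n⁆ l • FreeAlgebra.ι k (UMGen.X l))

/-- The algebra `UM(A)`: the free algebra on the generators modulo the defining relations. -/
def UM : Type _ := RingQuot (UMRel A b)

namespace UM

instance instRing : Ring (UM A b) := inferInstanceAs (Ring (RingQuot (UMRel A b)))

instance instAlgebra : Algebra k (UM A b) := inferInstanceAs (Algebra k (RingQuot (UMRel A b)))

/-- The canonical surjection from the free algebra. -/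
def mk : FreeAlgebra k (UMGen r d) →ₐ[k] UM A b := RingQuot.mkAlgHom k (UMRel A b)

/-- The class of `x_i`, `0 ≤ i ≤ r`. -/
def x (i : Fin (r + 1)) : UM A b := mk A b (FreeAlgebra.ι k (UMGen.x i))

/-- The class of the basis element `X_j` of `so(A)`. -/
def X (j : Fin d) : UM A b := mk A b (FreeAlgebra.ι k (UMGen.X j))

/-- The class of `y_i`, `1 ≤ i ≤ r`. -/
def y (i : Fin r) : UM A b := mk A b (FreeAlgebra.ι k (UMGen.y i))

/-- The linear map `so(A) → UM(A)` extending `X_j ↦ X_j`. -/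
def ofSo : soLie A →ₗ[k] UM A b := b.constr k (X A b)

/-- The generators in the order `x_0 < ... < x_r < X_1 < ... < X_d < y_1 < ... < y_r`. -/
def gens : Fin (r + 1 + d + r) → UM A b := Fin.append (Fin.append (x A b) (X A b)) (y A b)

end UM

end UM

end

/-!
`UM(A)` is a Hopf algebra because the proposed comultiplication, counit and antipode respect the
defining relations; the axioms then only have to be compared on generators. The one relation that
needs a computation is `[y_i, y_j] = (1/3) A_ij x_0 ^ 3`: the cross terms of `Δ(x_0) ^ 3` are
matched by the commutator of the wedge terms of `Δ(y_i)` and `Δ(y_j)` (`IsUMFamily.comul_yy`).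

Give `x_i` and `X_j` weight `1` and `y_i` weight `2`, and let `F` be the filtration of `UM(A)` by
the weight of words in the generators. Commutators of generators have smaller weight than the
products, so words may be reordered modulo smaller weight, and each step of `F` is spanned by
ordered monomials (`wordFiltration_le_span_orderedMonomial`). Moreover `Δ u - 1 ⊗ u` lies in
`H ⊗ F` of one step lower, so that every nonzero subcoalgebra contains `1`
(`one_mem_of_isSubcoalgebra`); this is connectedness. Once the ordered monomials are known to form
a basis, counting those of bounded weight gives the Gelfand-Kirillov dimension (`GKdim_eq`).

Linear independence of the ordered monomials does not use the Poincaré-Birkhoff-Witt theorem. In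
characteristic zero, ordered monomials in primitive elements that are linearly independent
together with `1` are linearly independent: comparing coefficients in the comultiplication of a
linear relation shows, by induction on the degree, that it has degree at most one
(`linearIndependent_orderedMonomial_of_primitive`). This applies to the enveloping algebra of the
Lie algebra of operators on `k ⊕ k^r ⊕ k^r ⊕ k`, which contains operators `x_0`, `x_i`, `X_j`
satisfying the relations of `UM(A)` and a second copy `x_i'` of the `x_i` with `[x_i', x_j'] =
(1/3) A_ij x_0`, commuting with the `x_i`. Since `[x_0 x_i', x_0 x_j'] = (1/3) A_ij x_0 ^ 3`,
sending `y_i` to `x_0 x_i'` defines a homomorphism from `UM(A)` to this enveloping algebra, and it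
maps distinct ordered monomials to distinct ordered monomials
(`UM.linearIndependent_orderedMonomial`).
-/

/-! ### The universal property of `UM(A)` -/

section UniversalProperty

variable {k : Type*} [Field k] {r d : ℕ} {A : Matrix (Fin r) (Fin r) k}
  {b : Module.Basis (Fin d) k (soLie A)} {B : Type*} [Ring B] [Algebra k B]

variable (A b) in
/-- A family of elements `fx 0, ..., fx r, fX 1, ..., fX d, fy 1, ..., fy r` of an algebra that
satisfies the defining relations of `UM(A)`. -/
structure IsUMFamily (fx : Fin (r + 1) → B) (fX : Fin d → B) (fy : Fin r → B) : Prop where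
  x0x : ∀ i, fx 0 * fx i = fx i * fx 0
  x0X : ∀ j, fx 0 * fX j = fX j * fx 0
  x0y : ∀ i, fx 0 * fy i = fy i * fx 0
  xx : ∀ i j : Fin r, fx i.succ * fx j.succ = fx j.succ * fx i.succ + A i j • fx 0
  yy : ∀ i j, fy i * fy j = fy j * fy i + (1 / 3 * A i j : k) • fx 0 ^ 3
  xy : ∀ (i j : Fin r), fx i.succ * fy j = fy j * fx i.succ
  xM : ∀ (i : Fin r) m, fx i.succ * fX m = fX m * fx i.succ + ∑ l, (b m).1 i l • fx l.succ
  yM : ∀ (i : Fin r) m, fy i * fX m = fX m * fy i + ∑ l, (b m).1 i l • fy l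
  MN : ∀ m n, fX m * fX n = fX n * fX m + ∑ l, b.repr ⁅b m, b n⁆ l • fX l

namespace UM

/-- The value of a family of elements at a generator. -/
def genVal (fx : Fin (r + 1) → B) (fX : Fin d → B) (fy : Fin r → B) : UMGen r d → B
  | .x i => fx i
  | .X j => fX j
  | .y i => fy i

variable {fx : Fin (r + 1) → B} {fX : Fin d → B} {fy : Fin r → B}

/-- A family of elements satisfying the defining relations defines a homomorphism on `UM(A)`. -/
def lift (h : IsUMFamily A b fx fX fy) : UM A b →ₐ[k] B :=
  RingQuot.liftAlgHom k (s := UMRel A b) ⟨FreeAlgebra.lift k (genVal fx fX fy), by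
    intro u v huv
    induction huv with
    | x0 g => cases g <;> simp [freeComm, genVal, h.x0x, h.x0X, h.x0y]
    | xx i j => simp [freeComm, genVal, h.xx i j]
    | yy i j => simp [freeComm, genVal, h.yy i j]
    | xy i j => simp [freeComm, genVal, h.xy i j]
    | xM i m => simp [freeComm, genVal, h.xM i m]
    | yM i m => simp [freeComm, genVal, h.yM i m]
    | MN m n => simp [freeComm, genVal, h.MN m n]⟩

theorem lift_mk (h : IsUMFamily A b fx fX fy) (u : FreeAlgebra k (UMGen r d)) :
    lift h (mk A b u) = FreeAlgebra.lift k (genVal fx fX fy) u :=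
  RingQuot.liftAlgHom_mkAlgHom_apply k _ _ _

@[simp] theorem lift_x (h : IsUMFamily A b fx fX fy) (i) : lift h (x A b i) = fx i := by
  simp [x, lift_mk, genVal]

@[simp] theorem lift_X (h : IsUMFamily A b fx fX fy) (i) : lift h (X A b i) = fX i := by
  simp [X, lift_mk, genVal]

@[simp] theorem lift_y (h : IsUMFamily A b fx fX fy) (i) : lift h (y A b i) = fy i := by
  simp [y, lift_mk, genVal]

/-- Homomorphisms on `UM(A)` that agree on the generators are equal. -/
theorem algHom_ext {f g : UM A b →ₐ[k] B} (hx : ∀ i, f (x A b i) = g (x A b i))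
    (hX : ∀ i, f (X A b i) = g (X A b i)) (hy : ∀ i, f (y A b i) = g (y A b i)) : f = g := by
  refine RingQuot.ringQuot_ext' (S := k) (s := UMRel A b) f g (FreeAlgebra.hom_ext ?_)
  funext u
  cases u
  exacts [hx _, hX _, hy _]

theorem mk_eq {u v : FreeAlgebra k (UMGen r d)} (h : UMRel A b u v) : mk A b u = mk A b v :=
  RingQuot.mkAlgHom_rel k h

variable (A b) in
theorem mk_surjective : Function.Surjective (mk A b) := RingQuot.mkAlgHom_surjective k (UMRel A b)

variable (A b) in
/-- The generators of `UM(A)` satisfy the defining relations. -/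
theorem isUMFamily : IsUMFamily A b (x A b) (X A b) (y A b) where
  x0x i := by simpa [freeComm, x, X, y, sub_eq_zero] using mk_eq (UMRel.x0 (A := A) (b := b) (.x i))
  x0X i := by simpa [freeComm, x, X, y, sub_eq_zero] using mk_eq (UMRel.x0 (A := A) (b := b) (.X i))
  x0y i := by simpa [freeComm, x, X, y, sub_eq_zero] using mk_eq (UMRel.x0 (A := A) (b := b) (.y i))
  xx i j := by
    simpa [freeComm, x, X, y, sub_eq_iff_eq_add'] using mk_eq (UMRel.xx (A := A) (b := b) i j)
  yy i j := by
    simpa [freeComm, x, X, y, sub_eq_iff_eq_add'] using mk_eq (UMRel.yy (A := A) (b := b) i j)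
  xy i j := by
    simpa [freeComm, x, X, y, sub_eq_zero] using mk_eq (UMRel.xy (A := A) (b := b) i j)
  xM i j := by
    simpa [freeComm, x, X, y, sub_eq_iff_eq_add'] using mk_eq (UMRel.xM (A := A) (b := b) i j)
  yM i j := by
    simpa [freeComm, x, X, y, sub_eq_iff_eq_add'] using mk_eq (UMRel.yM (A := A) (b := b) i j)
  MN i j := by
    simpa [freeComm, x, X, y, sub_eq_iff_eq_add'] using mk_eq (UMRel.MN (A := A) (b := b) i j)

theorem gens_x (i : Fin (r + 1)) : gens A b (Fin.castAdd r (Fin.castAdd d i)) = x A b i := by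
  simp [gens]

theorem gens_X (j : Fin d) : gens A b (Fin.castAdd r (Fin.natAdd (r + 1) j)) = X A b j := by
  simp [gens]

theorem gens_y (i : Fin r) : gens A b (Fin.natAdd (r + 1 + d) i) = y A b i := by
  simp [gens]

variable (A b) in
theorem forall_mem_range_gens {P : UM A b → Prop} (hx : ∀ i, P (x A b i)) (hX : ∀ j, P (X A b j))
    (hy : ∀ i, P (y A b i)) : ∀ g ∈ Set.range (gens A b), P g := by
  rintro _ ⟨i, rfl⟩
  induction i using Fin.addCases with
  | left i =>
    induction i using Fin.addCases with
    | left i => rw [gens_x]; exact hx i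
    | right i => rw [gens_X]; exact hX i
  | right i => rw [gens_y]; exact hy i

variable (A b) in
theorem adjoin_gens : Algebra.adjoin k (Set.range (gens A b)) = ⊤ := by
  refine top_unique fun u _ => ?_
  obtain ⟨u, rfl⟩ := mk_surjective A b u
  induction u using FreeAlgebra.induction with
  | grade0 c => simp
  | grade1 g =>
    refine Algebra.subset_adjoin ?_
    rcases g with i | j | i
    exacts [⟨_, gens_x i⟩, ⟨_, gens_X j⟩, ⟨_, gens_y i⟩]
  | mul a c ha hc => simpa using mul_mem (ha trivial) (hc trivial)
  | add a c ha hc => simpa using add_mem (ha trivial) (hc trivial)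

end UM

end UniversalProperty

/-! ### The Hopf algebra structure -/

section Hopf

variable {k : Type*} [Field k] {r d : ℕ} {A : Matrix (Fin r) (Fin r) k}
  {b : Module.Basis (Fin d) k (soLie A)}

namespace UM

/-- The commutator of two sums of four terms whose mixed terms commute. -/
theorem commutator_wedge {B : Type*} [Ring B] {a b c d a' b' c' d' a'' b'' c'' d'' : B}
    (ha : a * a' = a' * a + a'') (hb : b * b' = b' * b + b'') (hc : c * c' = c' * c + c'')
    (hd : d * d' = d' * d + d'') (hab : a * b' = b' * a) (hac : a * c' = c' * a)
    (had : a * d' = d' * a) (hba : b * a' = a' * b) (hbc : b * c' = c' * b) (hbd : b * d' = d' * b)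
    (hca : c * a' = a' * c) (hcb : c * b' = b' * c) (hcd : c * d' = d' * c) (hda : d * a' = a' * d)
    (hdb : d * b' = b' * d) (hdc : d * c' = c' * d) :
    (a + b + c - d) * (a' + b' + c' - d') =
      (a' + b' + c' - d') * (a + b + c - d) + (a'' + b'' + c'' + d'') := by
  simp only [add_mul, mul_add, sub_mul, mul_sub]
  rw [ha, hb, hc, hd, hab, hac, had, hba, hbc, hbd, hca, hcb, hcd, hda, hdb, hdc]
  abel

/-- The relation `[y_i, y_j] = (1/3) A_ij x_0 ^ 3` is compatible with the comultiplication: the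
cross terms of `Δ(x_0) ^ 3` are produced by the commutator of the wedge terms of `Δ(y_i)` and
`Δ(y_j)`. -/
theorem _root_.IsUMFamily.comul_yy [CharZero k] {B : Type*} [Ring B] [Algebra k B]
    {x : Fin (r + 1) → B} {X : Fin d → B} {y : Fin r → B} (h : IsUMFamily A b x X y) (i j : Fin r) :
    (y i ⊗ₜ[k] 1 + 1 ⊗ₜ y i + x 0 ⊗ₜ x i.succ - x i.succ ⊗ₜ x 0) *
        (y j ⊗ₜ[k] 1 + 1 ⊗ₜ y j + x 0 ⊗ₜ x j.succ - x j.succ ⊗ₜ x 0) =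
      (y j ⊗ₜ[k] 1 + 1 ⊗ₜ y j + x 0 ⊗ₜ x j.succ - x j.succ ⊗ₜ x 0) *
          (y i ⊗ₜ[k] 1 + 1 ⊗ₜ y i + x 0 ⊗ₜ x i.succ - x i.succ ⊗ₜ x 0) +
        (1 / 3 * A i j : k) • (x 0 ⊗ₜ[k] 1 + 1 ⊗ₜ x 0) ^ 3 := by
  have h3 : (x 0 ⊗ₜ[k] (1 : B) + 1 ⊗ₜ x 0) ^ 3 = (x 0 ^ 3) ⊗ₜ 1 + 1 ⊗ₜ (x 0 ^ 3)
      + (3 : k) • (x 0 ⊗ₜ (x 0 ^ 2)) + (3 : k) • ((x 0 ^ 2) ⊗ₜ x 0) := by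
    simp only [pow_succ, pow_zero, add_mul, mul_add, Algebra.TensorProduct.tmul_mul_tmul, one_mul,
      mul_one]
    module
  rw [commutator_wedge (a'' := (1 / 3 * A i j : k) • ((x 0 ^ 3) ⊗ₜ[k] 1))
    (b'' := (1 / 3 * A i j : k) • (1 ⊗ₜ[k] (x 0 ^ 3)))
    (c'' := A i j • ((x 0 ^ 2) ⊗ₜ[k] x 0)) (d'' := A i j • (x 0 ⊗ₜ[k] (x 0 ^ 2))), h3]
  · simp only [smul_add, smul_smul]
    rw [show (1 / 3 * A i j * 3) = A i j by field_simp]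
    abel
  all_goals simp only [Algebra.TensorProduct.tmul_mul_tmul, one_mul, mul_one, h.yy i j, h.xx i j,
    h.xy, h.x0y, h.x0x, pow_two, TensorProduct.add_tmul, TensorProduct.tmul_add,
    TensorProduct.tmul_smul, ← TensorProduct.smul_tmul']

/-- The elements `x_i ⊗ 1 + 1 ⊗ x_i`, `X_j ⊗ 1 + 1 ⊗ X_j` and
`y_i ⊗ 1 + 1 ⊗ y_i + x_0 ⊗ x_i - x_i ⊗ x_0` again satisfy the defining relations. -/
theorem _root_.IsUMFamily.comul [CharZero k] {B : Type*} [Ring B] [Algebra k B]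
    {x : Fin (r + 1) → B} {X : Fin d → B} {y : Fin r → B} (h : IsUMFamily A b x X y) :
    IsUMFamily A b (B := B ⊗[k] B)
      (fun i => x i ⊗ₜ 1 + 1 ⊗ₜ x i) (fun i => X i ⊗ₜ 1 + 1 ⊗ₜ X i)
      (fun i => y i ⊗ₜ 1 + 1 ⊗ₜ y i + x 0 ⊗ₜ x i.succ - x i.succ ⊗ₜ x 0) := by
  constructor
  · intro i
    simp only [add_mul, mul_add, Algebra.TensorProduct.tmul_mul_tmul, one_mul, mul_one, h.x0x]
    abel
  · intro i
    simp only [add_mul, mul_add, Algebra.TensorProduct.tmul_mul_tmul, one_mul, mul_one, h.x0X]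
    abel
  · intro i
    simp only [add_mul, mul_add, sub_mul, mul_sub, Algebra.TensorProduct.tmul_mul_tmul, one_mul,
      mul_one, h.x0x, h.x0y]
    abel
  · intro i j
    simp only [add_mul, mul_add, Algebra.TensorProduct.tmul_mul_tmul, one_mul, mul_one]
    rw [h.xx]
    simp only [TensorProduct.add_tmul, TensorProduct.tmul_add, TensorProduct.tmul_smul,
      ← TensorProduct.smul_tmul', smul_add]
    abel
  · exact h.comul_yy
  · intro i j
    simp only [add_mul, mul_add, sub_mul, mul_sub, Algebra.TensorProduct.tmul_mul_tmul, one_mul,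
      mul_one]
    rw [h.xx, h.xy, ← h.x0x]
    simp only [TensorProduct.add_tmul, TensorProduct.tmul_add, TensorProduct.tmul_smul,
      ← TensorProduct.smul_tmul']
    abel
  · intro i m
    simp only [add_mul, mul_add, Algebra.TensorProduct.tmul_mul_tmul, one_mul, mul_one]
    rw [h.xM]
    simp only [TensorProduct.add_tmul, TensorProduct.tmul_add, TensorProduct.tmul_smul,
      ← TensorProduct.smul_tmul', smul_add, TensorProduct.sum_tmul, TensorProduct.tmul_sum,
      Finset.sum_add_distrib]
    abel
  · intro i m
    simp only [add_mul, mul_add, sub_mul, mul_sub, Algebra.TensorProduct.tmul_mul_tmul, one_mul,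
      mul_one]
    rw [h.xM, h.yM, h.x0X]
    simp only [TensorProduct.add_tmul, TensorProduct.tmul_add, TensorProduct.tmul_smul,
      ← TensorProduct.smul_tmul', smul_add, smul_sub, TensorProduct.sum_tmul,
      TensorProduct.tmul_sum,
      Finset.sum_add_distrib, Finset.sum_sub_distrib]
    abel
  · intro i m
    simp only [add_mul, mul_add, Algebra.TensorProduct.tmul_mul_tmul, one_mul, mul_one]
    rw [h.MN]
    simp only [TensorProduct.add_tmul, TensorProduct.tmul_add, TensorProduct.tmul_smul,
      ← TensorProduct.smul_tmul', smul_add, TensorProduct.sum_tmul, TensorProduct.tmul_sum,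
      Finset.sum_add_distrib]
    abel

variable (A b) in
/-- The comultiplication of `UM(A)`. -/
def comulHom [CharZero k] : UM A b →ₐ[k] UM A b ⊗[k] UM A b := lift (isUMFamily A b).comul

variable (A b) in
theorem isUMFamily_zero : IsUMFamily A b (B := k) 0 0 0 := by
  constructor <;> simp

variable (A b) in
/-- The counit of `UM(A)`. -/
def counitHom : UM A b →ₐ[k] k := lift (isUMFamily_zero A b)

/-- The negatives of the generators satisfy the defining relations in the opposite algebra. In the
relations for `[x_i, x_j]` and `[y_i, y_j]` the right-hand sides change sign because they are of odd
degree in `x_0`. -/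
theorem isUMFamily_antipode (hA : A.transpose = -A) : IsUMFamily A b (B := (UM A b)ᵐᵒᵖ)
    (fun i => - .op (x A b i)) (fun i => - .op (X A b i)) (fun i => - .op (y A b i)) := by
  have h := isUMFamily A b
  have hA' : ∀ i j, A j i = - A i j := fun i j => congrFun (congrFun hA i) j
  constructor
  · intro i; simp [← MulOpposite.op_mul, h.x0x]
  · intro i; simp [← MulOpposite.op_mul, h.x0X]
  · intro i; simp [← MulOpposite.op_mul, h.x0y]
  · intro i j; simp [← MulOpposite.op_mul, h.xx i j]
  · intro i j; simp [← MulOpposite.op_mul, h.yy i j, Odd.neg_pow (by decide : Odd 3)]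
  · intro i j; simp [← MulOpposite.op_mul, h.xy i j]
  · intro i m; simp [← MulOpposite.op_mul, h.xM i m]
  · intro i m; simp [← MulOpposite.op_mul, h.yM i m]
  · intro m n; simp [← MulOpposite.op_mul, h.MN m n]

section CharZero

variable [CharZero k]

@[simp] theorem comulHom_x (i) : comulHom A b (x A b i) = x A b i ⊗ₜ 1 + 1 ⊗ₜ x A b i := lift_x _ _

@[simp] theorem comulHom_X (i) : comulHom A b (X A b i) = X A b i ⊗ₜ 1 + 1 ⊗ₜ X A b i := lift_X _ _

@[simp] theorem comulHom_y (i) : comulHom A b (y A b i) =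
    y A b i ⊗ₜ 1 + 1 ⊗ₜ y A b i + x A b 0 ⊗ₜ x A b i.succ - x A b i.succ ⊗ₜ x A b 0 := lift_y _ _

end CharZero

@[simp] theorem counitHom_x (i) : counitHom A b (x A b i) = 0 := lift_x _ _

@[simp] theorem counitHom_X (i) : counitHom A b (X A b i) = 0 := lift_X _ _

@[simp] theorem counitHom_y (i) : counitHom A b (y A b i) = 0 := lift_y _ _

variable (A b) in
/-- The bialgebra structure of `UM(A)`. -/
abbrev bialgebra [CharZero k] : Bialgebra k (UM A b) :=
  Bialgebra.ofAlgHom (comulHom A b) (counitHom A b)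
    (by
      refine algHom_ext ?_ ?_ ?_ <;> intro i <;>
        simp [TensorProduct.add_tmul, TensorProduct.tmul_add, TensorProduct.sub_tmul,
          TensorProduct.tmul_sub, Algebra.TensorProduct.one_def] <;> abel)
    (by refine algHom_ext ?_ ?_ ?_ <;> intro i <;> simp)
    (by refine algHom_ext ?_ ?_ ?_ <;> intro i <;> simp)

end UM

section Antipode

variable {H : Type*} [Ring H] [Bialgebra k H] (s : H →ₗ[k] H)

open Coalgebra

/-- If `∑ s(t₁) t₂` is a scalar `q`, then it can be pulled out of `∑ s((t u)₁) (t u)₂`. -/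
theorem mul'_rTensor_mul (hmul : ∀ a c, s (a * c) = s c * s a) {t : H ⊗[k] H} {q : k}
    (ht : LinearMap.mul' k H (s.rTensor H t) = algebraMap k H q) (u : H ⊗[k] H) :
    LinearMap.mul' k H (s.rTensor H (t * u)) = q • LinearMap.mul' k H (s.rTensor H u) := by
  induction u with
  | zero => simp
  | add u v hu hv => simp only [mul_add, map_add, hu, hv, smul_add]
  | tmul c₁ c₂ =>
    have : LinearMap.mul' k H (s.rTensor H (t * c₁ ⊗ₜ c₂)) =
        s c₁ * LinearMap.mul' k H (s.rTensor H t) * c₂ := by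
      clear ht
      induction t with
      | zero => simp
      | add t u ht hu => simp only [mul_add, add_mul, map_add, ht, hu]
      | tmul a₁ a₂ => simp [hmul, mul_assoc]
    rw [this, ht, ← Algebra.commutes, mul_assoc, Algebra.smul_def]
    simp

/-- If `∑ u₁ s(u₂)` is a scalar `q`, then it can be pulled out of `∑ (t u)₁ s((t u)₂)`. -/
theorem mul'_lTensor_mul (hmul : ∀ a c, s (a * c) = s c * s a) (t : H ⊗[k] H) {u : H ⊗[k] H} {q : k}
    (hu : LinearMap.mul' k H (s.lTensor H u) = algebraMap k H q) :
    LinearMap.mul' k H (s.lTensor H (t * u)) = q • LinearMap.mul' k H (s.lTensor H t) := by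
  induction t with
  | zero => simp
  | add t v ht hv => simp only [add_mul, map_add, ht, hv, smul_add]
  | tmul a₁ a₂ =>
    have : LinearMap.mul' k H (s.lTensor H (a₁ ⊗ₜ a₂ * u)) =
        a₁ * LinearMap.mul' k H (s.lTensor H u) * s a₂ := by
      clear hu
      induction u with
      | zero => simp
      | add t u ht hu => simp only [mul_add, add_mul, map_add, ht, hu]
      | tmul c₁ c₂ => simp [hmul, mul_assoc]
    rw [this, hu, ← Algebra.commutes, mul_assoc, Algebra.smul_def]
    simp

/-- A linear anti-endomorphism of a bialgebra is an antipode as soon as the antipode axioms hold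
on a set of algebra generators. -/
abbrev HopfAlgebra.ofGenerators (hone : s 1 = 1) (hmul : ∀ a c, s (a * c) = s c * s a) {G : Set H}
    (hG : Algebra.adjoin k G = ⊤)
    (hl : ∀ g ∈ G, LinearMap.mul' k H (s.rTensor H (comul g)) = algebraMap k H (counit g))
    (hr : ∀ g ∈ G, LinearMap.mul' k H (s.lTensor H (comul g)) = algebraMap k H (counit g)) :
    HopfAlgebra k H where
  antipode := s
  mul_antipode_rTensor_comul := by
    ext a
    have ha : a ∈ Algebra.adjoin k G := hG ▸ Algebra.mem_top
    simp only [LinearMap.comp_apply, Algebra.linearMap_apply]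
    induction ha using Algebra.adjoin_induction with
    | mem g hg => exact hl g hg
    | algebraMap c => simp [Algebra.algebraMap_eq_smul_one, Algebra.TensorProduct.one_def, hone]
    | add a c _ _ ha hc => simp only [map_add, ha, hc]
    | mul a c _ _ ha hc =>
      rw [Bialgebra.comul_mul, mul'_rTensor_mul s hmul ha, hc, Bialgebra.counit_mul, map_mul,
        Algebra.smul_def]
  mul_antipode_lTensor_comul := by
    ext a
    have ha : a ∈ Algebra.adjoin k G := hG ▸ Algebra.mem_top
    simp only [LinearMap.comp_apply, Algebra.linearMap_apply]
    induction ha using Algebra.adjoin_induction with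
    | mem g hg => exact hr g hg
    | algebraMap c => simp [Algebra.algebraMap_eq_smul_one, Algebra.TensorProduct.one_def, hone]
    | add a c _ _ ha hc => simp only [map_add, ha, hc]
    | mul a c _ _ ha hc =>
      rw [Bialgebra.comul_mul, mul'_lTensor_mul s hmul _ hc, ha, Bialgebra.counit_mul, map_mul,
        Algebra.smul_def, Algebra.commutes]

end Antipode

namespace UM

/-- The antipode of `UM(A)`, as an anti-endomorphism. -/
def antipodeHom (hA : A.transpose = -A) : UM A b →ₐ[k] (UM A b)ᵐᵒᵖ := lift (isUMFamily_antipode hA)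

/-- The antipode of `UM(A)`. -/
def antipodeMap (hA : A.transpose = -A) : UM A b →ₗ[k] UM A b :=
  (MulOpposite.opLinearEquiv k).symm.toLinearMap ∘ₗ (antipodeHom hA).toLinearMap

variable (hA : A.transpose = -A)

@[simp] theorem antipodeMap_x (i) : antipodeMap hA (x A b i) = - x A b i := by
  simp [antipodeMap, antipodeHom]

@[simp] theorem antipodeMap_X (i) : antipodeMap hA (X A b i) = - X A b i := by
  simp [antipodeMap, antipodeHom]

@[simp] theorem antipodeMap_y (i) : antipodeMap hA (y A b i) = - y A b i := by
  simp [antipodeMap, antipodeHom]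

@[simp] theorem antipodeMap_one : antipodeMap hA (1 : UM A b) = 1 := by
  simp [antipodeMap, antipodeHom]

theorem antipodeMap_mul (u v : UM A b) :
    antipodeMap hA (u * v) = antipodeMap hA v * antipodeMap hA u := by
  simp [antipodeMap, antipodeHom]

variable [CharZero k]

variable (b) in
/-- The Hopf algebra structure of `UM(A)`. -/
abbrev hopfAlgebra : HopfAlgebra k (UM A b) :=
  letI := bialgebra A b
  HopfAlgebra.ofGenerators (antipodeMap hA) (antipodeMap_one hA) (antipodeMap_mul hA)
    (adjoin_gens A b)
    (by
      change ∀ g ∈ Set.range (gens A b), LinearMap.mul' k (UM A b)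
        (LinearMap.rTensor _ _ (comulHom A b g)) = algebraMap _ _ (counitHom A b g)
      refine forall_mem_range_gens A b (fun i => ?_) (fun i => ?_) (fun i => ?_)
      · simp
      · simp
      · simp [(isUMFamily A b).x0x i.succ])
    (by
      change ∀ g ∈ Set.range (gens A b), LinearMap.mul' k (UM A b)
        (LinearMap.lTensor _ _ (comulHom A b g)) = algebraMap _ _ (counitHom A b g)
      refine forall_mem_range_gens A b (fun i => ?_) (fun i => ?_) (fun i => ?_)
      · simp
      · simp
      · simp [(isUMFamily A b).x0x i.succ])

theorem hopfAlgebra_toAlgebra : (hopfAlgebra b hA).toAlgebra = instAlgebra A b := rfl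

theorem isPrimitiveElt_x (i) : letI := hopfAlgebra b hA; IsPrimitiveElt k (x A b i) :=
  comulHom_x i

theorem isPrimitiveElt_ofSo (M : soLie A) : letI := hopfAlgebra b hA;
    IsPrimitiveElt k (ofSo A b M) := by
  change comulHom A b (ofSo A b M) = _
  rw [ofSo, b.constr_apply_fintype k]
  simp [TensorProduct.sum_tmul, TensorProduct.tmul_sum, Finset.sum_add_distrib,
    TensorProduct.smul_tmul']

theorem isWedgeElt_y (i) : letI := hopfAlgebra b hA;
    IsWedgeElt k (x A b 0) (x A b i.succ) (y A b i) :=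
  letI := hopfAlgebra b hA
  ⟨comulHom_y i, counitHom_y i, antipodeMap_y hA i⟩

end UM
end Hopf

/-! ### Weight filtrations -/

section WeightFiltration

variable (k : Type*) {B : Type*} [Field k] [Ring B] [Algebra k B] {n : ℕ} (z : Fin n → B)
  (w : Fin n → ℕ)

/-- The span of all words in the elements `z i` of weight less than `m`, the letter `z i` having
weight `w i`. The inequality is strict so that the step `0` of the filtration vanishes. -/
def wordFiltration (m : ℕ) : Submodule k B :=
  Submodule.span k ((fun l : List (Fin n) => (l.map z).prod) '' {l | (l.map w).sum < m})

variable {k z w}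

theorem word_mem_wordFiltration {l : List (Fin n)} {m : ℕ} (h : (l.map w).sum < m) :
    (l.map z).prod ∈ wordFiltration k z w m :=
  Submodule.subset_span ⟨l, h, rfl⟩

theorem letter_mem_wordFiltration {i : Fin n} {m : ℕ} (h : w i < m) :
    z i ∈ wordFiltration k z w m := by
  simpa using word_mem_wordFiltration (k := k) (z := z) (w := w) (l := [i]) (by simpa using h)

theorem one_mem_wordFiltration {m : ℕ} (h : 0 < m) : 1 ∈ wordFiltration k z w m := by
  simpa using word_mem_wordFiltration (k := k) (z := z) (w := w) (l := []) (by simpa using h)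

@[simp] theorem wordFiltration_zero : wordFiltration k z w 0 = ⊥ := by
  simp [wordFiltration]

theorem wordFiltration_mono {m m' : ℕ} (h : m ≤ m') :
    wordFiltration k z w m ≤ wordFiltration k z w m' :=
  Submodule.span_mono (Set.image_mono fun _ hl => lt_of_lt_of_le hl h)

/-- The filtration is multiplicative; the bound `m + 1` accounts for the two strict inequalities in
the definition of the filtration. -/
theorem mul_mem_wordFiltration {p q m : ℕ} (h : p + q ≤ m + 1) {u v : B}
    (hu : u ∈ wordFiltration k z w p) (hv : v ∈ wordFiltration k z w q) :
    u * v ∈ wordFiltration k z w m := by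
  have : wordFiltration k z w p * wordFiltration k z w q ≤ wordFiltration k z w m := by
    rw [wordFiltration, wordFiltration, Submodule.span_mul_span, Submodule.span_le]
    rintro _ ⟨_, ⟨l, hl, rfl⟩, _, ⟨l', hl', rfl⟩, rfl⟩
    simp only [Set.mem_ofPred_eq] at hl hl'
    have := word_mem_wordFiltration (k := k) (z := z) (w := w) (l := l ++ l') (m := m)
      (by rw [List.map_append, List.sum_append]; omega)
    simpa using this
  exact this (Submodule.mul_mem_mul hu hv)

theorem exists_mem_wordFiltration (hz : Algebra.adjoin k (Set.range z) = ⊤) (w : Fin n → ℕ)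
    (u : B) : ∃ m, u ∈ wordFiltration k z w m := by
  have hu : u ∈ Algebra.adjoin k (Set.range z) := hz ▸ Algebra.mem_top
  induction hu using Algebra.adjoin_induction with
  | mem u hu =>
    obtain ⟨i, rfl⟩ := hu
    exact ⟨_, letter_mem_wordFiltration (Nat.lt_succ_self _)⟩
  | algebraMap c =>
    rw [Algebra.algebraMap_eq_smul_one]
    exact ⟨1, Submodule.smul_mem _ _ (one_mem_wordFiltration one_pos)⟩
  | add u v _ _ hu hv =>
    obtain ⟨p, hp⟩ := hu
    obtain ⟨q, hq⟩ := hv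
    exact ⟨max p q, add_mem (wordFiltration_mono (le_max_left _ _) hp)
      (wordFiltration_mono (le_max_right _ _) hq)⟩
  | mul u v _ _ hu hv =>
    obtain ⟨p, hp⟩ := hu
    obtain ⟨q, hq⟩ := hv
    exact ⟨p + q, mul_mem_wordFiltration (Nat.le_succ _) hp hq⟩

/-- If the commutator of two letters has smaller weight than their product, rearranging a word
changes it only by terms of smaller weight. -/
theorem word_sub_word_mem_of_perm
    (hz : ∀ i j, z i * z j - z j * z i ∈ wordFiltration k z w (w i + w j)) {l l' : List (Fin n)}
    (h : l.Perm l') :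
    (l.map z).prod - (l'.map z).prod ∈ wordFiltration k z w (l.map w).sum := by
  induction h with
  | nil => simp
  | @cons i l l' _ ih =>
    simp only [List.map_cons, List.prod_cons, List.sum_cons, ← mul_sub]
    exact mul_mem_wordFiltration (by omega) (letter_mem_wordFiltration (Nat.lt_succ_self _)) ih
  | swap i j l =>
    simp only [List.map_cons, List.prod_cons, List.sum_cons, ← mul_assoc, ← sub_mul]
    exact mul_mem_wordFiltration (by omega) (hz j i)
      (word_mem_wordFiltration (l := l) (Nat.lt_succ_self _))
  | @trans l₁ l₂ l₃ h _ ih ih' =>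
    rw [← (h.map w).sum_eq] at ih'
    simpa using add_mem ih ih'

variable (z) in
/-- The ordered monomial with exponents `e`. -/
def orderedMonomial (e : Fin n → ℕ) : B := (List.ofFn fun i => z i ^ e i).prod

/-- The ordered monomial with exponents `e`, as a word. -/
def orderedWord (e : Fin n → ℕ) : List (Fin n) :=
  (List.ofFn fun i => List.replicate (e i) i).flatten

theorem prod_orderedWord (e : Fin n → ℕ) : ((orderedWord e).map z).prod = orderedMonomial z e := by
  simp [orderedWord, orderedMonomial, List.map_flatten, List.prod_flatten, List.map_ofFn,
    Function.comp_def]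

theorem orderedWord_count_perm (l : List (Fin n)) : l.Perm (orderedWord fun i => l.count i) := by
  rw [List.perm_iff_count]
  intro a
  simp [orderedWord, List.count_flatten, List.map_ofFn, Function.comp_def, List.count_replicate,
    List.sum_ofFn]

theorem sum_orderedWord (e : Fin n → ℕ) : ((orderedWord e).map w).sum = ∑ i, e i * w i := by
  simp [orderedWord, List.map_flatten, List.sum_flatten, List.map_ofFn, Function.comp_def,
    List.sum_ofFn]

/-- If the commutators of the letters have smaller weight, every step of the filtration is spanned
by the ordered monomials of that weight. -/
theorem wordFiltration_le_span_orderedMonomial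
    (hz : ∀ i j, z i * z j - z j * z i ∈ wordFiltration k z w (w i + w j)) (m : ℕ) :
    wordFiltration k z w m ≤
      Submodule.span k (orderedMonomial z '' {e | ∑ i, e i * w i < m}) := by
  induction m with
  | zero => simp
  | succ m ih =>
    refine Submodule.span_le.2 ?_
    rintro _ ⟨l, hl, rfl⟩
    have hp := orderedWord_count_perm l
    have h1 := word_sub_word_mem_of_perm hz hp
    have h2 := ih (wordFiltration_mono (Nat.lt_succ_iff.1 hl) h1)
    refine (Submodule.sub_mem_iff_left _ ?_).1
      (Submodule.span_mono (Set.image_mono fun e he => Nat.lt_succ_of_lt he) h2)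
    refine Submodule.subset_span ⟨_, ?_, (prod_orderedWord _).symm⟩
    rw [Set.mem_ofPred_eq, ← sum_orderedWord, ← (hp.map w).sum_eq]
    exact hl

theorem span_orderedMonomial_eq_top (hz : Algebra.adjoin k (Set.range z) = ⊤)
    (hc : ∀ i j, z i * z j - z j * z i ∈ wordFiltration k z w (w i + w j)) :
    Submodule.span k (Set.range (orderedMonomial z)) = ⊤ := by
  refine top_unique fun u _ => ?_
  obtain ⟨m, hm⟩ := exists_mem_wordFiltration hz w u
  exact Submodule.span_mono (Set.image_subset_range _ _)
    (wordFiltration_le_span_orderedMonomial hc m hm)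

end WeightFiltration

/-! ### Connectedness -/

section Connected

variable {k : Type*} {H : Type*} [Field k] [Ring H] {n : ℕ} {z : Fin n → H}
  {w : Fin n → ℕ}

section

variable [Algebra k H]

variable (k z w) in
/-- The subspace `H ⊗ F m` of `H ⊗ H`, where `F` is the weight filtration of `H`. -/
def tensorFiltration (m : ℕ) : Submodule k (H ⊗[k] H) :=
  LinearMap.range ((wordFiltration k z w m).subtype.lTensor H)

theorem tmul_mem_tensorFiltration (u : H) {v : H} {m : ℕ} (hv : v ∈ wordFiltration k z w m) :
    u ⊗ₜ v ∈ tensorFiltration k z w m :=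
  ⟨u ⊗ₜ ⟨v, hv⟩, rfl⟩

theorem mul_mem_tensorFiltration {p q m : ℕ} (h : p + q ≤ m + 1) {s t : H ⊗[k] H}
    (hs : s ∈ tensorFiltration k z w p) (ht : t ∈ tensorFiltration k z w q) :
    s * t ∈ tensorFiltration k z w m := by
  obtain ⟨s, rfl⟩ := hs
  obtain ⟨t, rfl⟩ := ht
  induction s with
  | zero => simp
  | add s s' hs hs' => rw [map_add, add_mul]; exact add_mem hs hs'
  | tmul a u =>
    induction t with
    | zero => simp
    | add t t' ht ht' => rw [map_add, mul_add]; exact add_mem ht ht'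
    | tmul a' u' =>
      simpa using tmul_mem_tensorFiltration (a * a') (mul_mem_wordFiltration h u.2 u'.2)

theorem tensorFiltration_mono {m m' : ℕ} (h : m ≤ m') :
    tensorFiltration k z w m ≤ tensorFiltration k z w m' := by
  rintro _ ⟨t, rfl⟩
  induction t with
  | zero => simp
  | add s s' hs hs' => rw [map_add]; exact add_mem hs hs'
  | tmul a u => exact tmul_mem_tensorFiltration _ (wordFiltration_mono h u.2)

end

open Coalgebra

section

variable [Bialgebra k H]

/-- If `Δ(z i) - 1 ⊗ z i` lies in `H ⊗ F (w i)` for all letters, then `Δ u - 1 ⊗ u` lies in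
`H ⊗ F m` for all `u` in `F (m + 1)`. -/
theorem comul_sub_mem_tensorFiltration
    (hz : ∀ i, comul (R := k) (z i) - 1 ⊗ₜ z i ∈ tensorFiltration k z w (w i)) {m : ℕ} {u : H}
    (hu : u ∈ wordFiltration k z w (m + 1)) :
    comul (R := k) u - 1 ⊗ₜ u ∈ tensorFiltration k z w m := by
  have hword : ∀ l : List (Fin n), comul (R := k) (l.map z).prod - 1 ⊗ₜ (l.map z).prod ∈
      tensorFiltration k z w (l.map w).sum := by
    intro l
    induction l with
    | nil => simp [Algebra.TensorProduct.one_def]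
    | cons i l ih =>
      simp only [List.map_cons, List.prod_cons, List.sum_cons]
      set v := (l.map z).prod with hv
      have hv' : comul (R := k) v ∈ tensorFiltration k z w ((l.map w).sum + 1) := by
        have := add_mem (tensorFiltration_mono (Nat.le_succ _) ih) (tmul_mem_tensorFiltration 1
          (word_mem_wordFiltration (k := k) (z := z) (Nat.lt_succ_self (l.map w).sum)))
        simpa [← hv] using this
      have : comul (R := k) (z i * v) - 1 ⊗ₜ (z i * v) =
          (comul (R := k) (z i) - 1 ⊗ₜ z i) * comul (R := k) v +
            1 ⊗ₜ z i * (comul (R := k) v - 1 ⊗ₜ v) := by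
        rw [Bialgebra.comul_mul, sub_mul, mul_sub, Algebra.TensorProduct.tmul_mul_tmul, one_mul]
        abel
      rw [this]
      exact add_mem (mul_mem_tensorFiltration (by omega) (hz i) hv') (mul_mem_tensorFiltration
        (by omega) (tmul_mem_tensorFiltration 1
          (letter_mem_wordFiltration (Nat.lt_succ_self _))) ih)
  induction hu using Submodule.span_induction with
  | mem u hu =>
    obtain ⟨l, hl, rfl⟩ := hu
    exact tensorFiltration_mono (Nat.lt_succ_iff.1 hl) (hword l)
  | zero => simp
  | add u v _ _ hu hv =>
    simpa [TensorProduct.tmul_add, add_sub_add_comm] using add_mem hu hv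
  | smul c u _ hu =>
    simpa [smul_sub] using Submodule.smul_mem _ c hu

/-- A nonzero subcoalgebra `D` contains `1`: if `d` is a nonzero element of `D` of least weight and
`f` a functional with `f d ≠ 0` that vanishes on smaller weights, then `(id ⊗ f) (Δ d)` is a nonzero
multiple of `1`. -/
theorem one_mem_of_isSubcoalgebra (hgen : Algebra.adjoin k (Set.range z) = ⊤)
    (hz : ∀ i, comul (R := k) (z i) - 1 ⊗ₜ z i ∈ tensorFiltration k z w (w i)) {D : Submodule k H}
    (hD : IsSubcoalgebra k D) (hD0 : D ≠ ⊥) : 1 ∈ D := by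
  classical
  have hex : ∃ m, ∃ d ∈ D, d ≠ 0 ∧ d ∈ wordFiltration k z w m := by
    obtain ⟨d, hd, hd0⟩ := D.ne_bot_iff.1 hD0
    obtain ⟨m, hm⟩ := exists_mem_wordFiltration hgen w d
    exact ⟨m, d, hd, hd0, hm⟩
  obtain ⟨d, hd, hd0, hdm⟩ := Nat.find_spec hex
  obtain ⟨m, hm⟩ : ∃ m, Nat.find hex = m + 1 := by
    refine Nat.exists_eq_succ_of_ne_zero fun h => hd0 ?_
    simpa [h] using hdm
  rw [hm] at hdm
  have hdm' : d ∉ wordFiltration k z w m := fun h =>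
    Nat.find_min hex (m := m) (by omega) ⟨d, hd, hd0, h⟩
  obtain ⟨f, hf, hfm⟩ := Submodule.exists_le_ker_of_notMem hdm'
  -- `P` is `id ⊗ f`; it maps `D ⊗ D` to `D`
  let P : H ⊗[k] H →ₗ[k] H := (TensorProduct.rid k H).toLinearMap ∘ₗ f.lTensor H
  have hP : ∀ t ∈ tensorFiltration k z w m, P t = 0 := by
    rintro _ ⟨t, rfl⟩
    induction t with
    | zero => simp
    | add s t hs ht => rw [map_add, map_add, hs, ht, add_zero]
    | tmul a u =>
      have : f u = 0 := hfm u.2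
      simp [P, this]
  have h1 : P (comul d) = f d • 1 := by
    have := hP _ (comul_sub_mem_tensorFiltration hz hdm)
    rw [map_sub, sub_eq_zero] at this
    rw [this]
    simp [P]
  have h2 : P (comul d) ∈ D := by
    obtain ⟨t, ht⟩ := hD d hd
    rw [← ht]
    clear ht
    induction t with
    | zero => simp
    | add s t hs ht => rw [map_add, map_add]; exact add_mem hs ht
    | tmul a u => simpa [P] using D.smul_mem _ a.2
  rw [h1] at h2
  exact (Submodule.smul_mem_iff _ hf).1 h2

end

/-- A Hopf algebra with a weight filtration as above is connected. -/
theorem isConnectedHopf_of_weight [HopfAlgebra k H] (hgen : Algebra.adjoin k (Set.range z) = ⊤)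
    (hz : ∀ i, comul (R := k) (z i) - 1 ⊗ₜ z i ∈ tensorFiltration k z w (w i)) :
    IsConnectedHopf k H := by
  have : Nontrivial H := Bialgebra.nontrivial k
  have hatom : IsAtom (Submodule.span k {(1 : H)}) := nonzero_span_atom 1 one_ne_zero
  have hsub : IsSubcoalgebra k (Submodule.span k {(1 : H)}) := by
    intro c hc
    obtain ⟨a, rfl⟩ := Submodule.mem_span_singleton.1 hc
    refine ⟨a • (⟨1, Submodule.mem_span_singleton_self 1⟩ ⊗ₜ
      ⟨1, Submodule.mem_span_singleton_self 1⟩), ?_⟩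
    simp [TensorProduct.mapIncl, Algebra.TensorProduct.one_def]
  refine le_antisymm (sSup_le fun D hD => ?_) (le_sSup ⟨hsub, hatom.1, fun E _ hE => ?_⟩)
  · have h1 : Submodule.span k {(1 : H)} ≤ D :=
      (Submodule.span_singleton_le_iff_mem _ _).2 (one_mem_of_isSubcoalgebra hgen hz hD.1 hD.2.1)
    exact ((hD.2.2 _ hsub h1).resolve_left hatom.1).ge
  · exact hatom.le_iff.1 hE

end Connected

/-! ### Gelfand-Kirillov dimension -/

section Growth

variable {k : Type*} {B : Type*} [Field k] [Ring B] [Algebra k B] {n : ℕ} {z : Fin n → B}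
  {w : Fin n → ℕ}

open Filter Topology

theorem setOf_weight_lt_subset (hw : ∀ i, 1 ≤ w i) (m : ℕ) :
    {e : Fin n → ℕ | ∑ i, e i * w i < m} ⊆
      ↑(Fintype.piFinset fun _ : Fin n => Finset.range m) := by
  intro e he
  rw [Finset.mem_coe, Fintype.mem_piFinset]
  intro i
  rw [Finset.mem_range]
  calc e i ≤ e i * w i := Nat.le_mul_of_pos_right _ (hw i)
    _ ≤ ∑ i, e i * w i := Finset.single_le_sum (f := fun i => e i * w i) (fun _ _ => Nat.zero_le _)
      (Finset.mem_univ i)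
    _ < m := he

/-- The step `m` of the weight filtration is spanned by at most `m ^ n` ordered monomials. -/
theorem finrank_le_of_le_wordFiltration (hw : ∀ i, 1 ≤ w i)
    (hc : ∀ i j, z i * z j - z j * z i ∈ wordFiltration k z w (w i + w j)) {m : ℕ}
    {V : Submodule k B} (hV : V ≤ wordFiltration k z w m) : Module.finrank k V ≤ m ^ n := by
  classical
  let S : Finset B := (Fintype.piFinset fun _ => Finset.range m).image (orderedMonomial z)
  have hVS : V ≤ Submodule.span k (S : Set B) := by
    refine (hV.trans (wordFiltration_le_span_orderedMonomial hc m)).trans (Submodule.span_mono ?_)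
    rw [Finset.coe_image]
    exact Set.image_mono (setOf_weight_lt_subset hw m)
  calc Module.finrank k V ≤ Module.finrank k (Submodule.span k (S : Set B)) :=
      Submodule.finrank_mono hVS
    _ ≤ S.card := finrank_span_finset_le_card S
    _ ≤ (Fintype.piFinset fun _ : Fin n => Finset.range m).card := Finset.card_image_le
    _ = m ^ n := by simp

theorem pow_le_wordFiltration {V : Submodule k B} {s : ℕ} (hV : V ≤ wordFiltration k z w (s + 1))
    (i : ℕ) : V ^ i ≤ wordFiltration k z w (s * i + 1) := by
  induction i with
  | zero =>
    rw [pow_zero, Submodule.one_eq_span, Submodule.span_singleton_le_iff_mem]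
    exact one_mem_wordFiltration (by omega)
  | succ i ih =>
    rw [pow_succ, Submodule.mul_le]
    intro u hu v hv
    exact mul_mem_wordFiltration (by rw [mul_add]; omega) (ih hu) (hV hv)

theorem exists_le_wordFiltration (hz : Algebra.adjoin k (Set.range z) = ⊤) (w : Fin n → ℕ)
    (V : Submodule k B) [FiniteDimensional k V] : ∃ s, V ≤ wordFiltration k z w (s + 1) := by
  obtain ⟨S, rfl⟩ := (Submodule.fg_iff_finiteDimensional V).2 inferInstance
  choose m hm using exists_mem_wordFiltration hz w
  refine ⟨S.sup m, Submodule.span_le.2 fun u hu => ?_⟩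
  exact wordFiltration_mono ((Finset.le_sup hu).trans (Nat.le_succ _)) (hm u)

theorem tendsto_const_div_log (c : ℝ) :
    Tendsto (fun N : ℕ => c / Real.log N) atTop (𝓝 0) :=
  (Real.tendsto_log_atTop.comp tendsto_natCast_atTop_atTop).const_div_atTop _

/-- A finite-dimensional subspace lies in some step `s + 1` of the filtration, so its powers up to
`N` span a space of dimension at most `((s + 1) N) ^ n`. -/
theorem GKdim_le (hz : Algebra.adjoin k (Set.range z) = ⊤) (hw : ∀ i, 1 ≤ w i)
    (hc : ∀ i j, z i * z j - z j * z i ∈ wordFiltration k z w (w i + w j)) :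
    GKdim k B ≤ (n : EReal) := by
  refine iSup_le fun V => ?_
  obtain ⟨V, hV⟩ := V
  obtain ⟨s, hs⟩ := exists_le_wordFiltration hz w V
  have hlim : Tendsto (fun N : ℕ => ((n * (Real.log (s + 1 : ℕ) / Real.log N + 1) : ℝ) : EReal))
      atTop (𝓝 (n : EReal)) := by
    have := ((tendsto_const_div_log (Real.log (s + 1 : ℕ))).add_const 1).const_mul (n : ℝ)
    rw [zero_add, mul_one] at this
    exact (continuous_coe_real_ereal.tendsto _).comp this
  rw [← hlim.limsup_eq]
  refine limsup_le_limsup ?_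
  filter_upwards [eventually_ge_atTop 2] with N hN
  rw [EReal.coe_le_coe_iff]
  have hN0 : (N : ℝ) ≠ 0 := by positivity
  have hlogN : 0 < Real.log N := Real.log_pos (by exact_mod_cast hN)
  have hle : (⨆ i ∈ Finset.range (N + 1), V ^ i) ≤ wordFiltration k z w ((s + 1) * N) := by
    refine iSup₂_le fun i hi => (pow_le_wordFiltration hs i).trans (wordFiltration_mono ?_)
    have : s * i ≤ s * N := Nat.mul_le_mul_left s (Nat.lt_succ_iff.1 (Finset.mem_range.1 hi))
    rw [add_mul]
    omega
  have hfin := finrank_le_of_le_wordFiltration hw hc hle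
  rw [div_le_iff₀ hlogN, mul_assoc, add_mul, div_mul_cancel₀ _ hlogN.ne', one_mul,
    ← Real.log_mul (by positivity) hN0, ← Real.log_pow]
  -- `Real.log 0 = 0`, so a vanishing dimension has to be treated separately
  rcases Nat.eq_zero_or_pos (Module.finrank k ↥(⨆ i ∈ Finset.range (N + 1), V ^ i)) with h0 | h0
  · rw [h0, Nat.cast_zero, Real.log_zero]
    exact_mod_cast Real.log_natCast_nonneg (((s + 1) * N) ^ n)
  · exact Real.log_le_log (by exact_mod_cast h0) (by exact_mod_cast hfin)

theorem orderedMonomial_mem_pow {V : Submodule k B} (hV : ∀ i, z i ∈ V) (e : Fin n → ℕ) :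
    orderedMonomial z e ∈ V ^ (∑ i, e i) := by
  have hword : ∀ l : List (Fin n), (l.map z).prod ∈ V ^ l.length := by
    intro l
    induction l with
    | nil => simpa using ⟨1, map_one _⟩
    | cons i l ih =>
      rw [List.map_cons, List.prod_cons, List.length_cons, pow_succ']
      exact Submodule.mul_mem_mul (hV i) ih
  have := hword (orderedWord e)
  rw [prod_orderedWord] at this
  convert this
  simp [orderedWord, List.length_flatten, List.map_ofFn, Function.comp_def, List.sum_ofFn]

/-- The powers up to `N` of the span of the letters contain the `(N / n + 1) ^ n` ordered monomials
with all exponents at most `N / n`. -/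
theorem le_GKdim (hli : LinearIndependent k (orderedMonomial z)) : (n : EReal) ≤ GKdim k B := by
  let V : Submodule k B := Submodule.span k (Set.range z)
  have hV : FiniteDimensional k V := FiniteDimensional.span_of_finite k (Set.finite_range z)
  refine le_trans ?_ (le_iSup _ (⟨V, hV⟩ : {V : Submodule k B // FiniteDimensional k V}))
  have hlim : Tendsto (fun N : ℕ => ((n * (1 - Real.log n / Real.log N) : ℝ) : EReal))
      atTop (𝓝 (n : EReal)) := by
    have := ((tendsto_const_div_log (Real.log n)).const_sub 1).const_mul (n : ℝ)
    rw [sub_zero, mul_one] at this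
    exact (continuous_coe_real_ereal.tendsto _).comp this
  rw [← hlim.limsup_eq]
  refine limsup_le_limsup ?_
  filter_upwards [eventually_ge_atTop 2] with N hN
  rw [EReal.coe_le_coe_iff]
  have hlogN : 0 < Real.log N := Real.log_pos (by exact_mod_cast hN)
  set W : Submodule k B := ⨆ i ∈ Finset.range (N + 1), V ^ i with hW
  have hWfin : FiniteDimensional k W := by
    refine Module.Finite.iff_fg.2 (Submodule.fg_biSup _ _ fun i _ => ?_)
    exact ((Submodule.fg_iff_finiteDimensional V).2 hV).pow i
  have hcard : (N / n + 1) ^ n ≤ Module.finrank k W := by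
    let g : (Fin n → Fin (N / n + 1)) → W := fun e => ⟨orderedMonomial z fun i => e i, by
      have he : ∑ i, (e i : ℕ) ≤ N := calc
        ∑ i, (e i : ℕ) ≤ ∑ _i : Fin n, N / n :=
          Finset.sum_le_sum fun i _ => Nat.lt_succ_iff.1 (e i).2
        _ ≤ N := by simpa using Nat.mul_div_le N n
      have hle := le_iSup₂ (f := fun i (_ : i ∈ Finset.range (N + 1)) => V ^ i) (∑ i, (e i : ℕ))
        (Finset.mem_range.2 (Nat.lt_succ_of_le he))
      exact hle (orderedMonomial_mem_pow (fun i => Submodule.subset_span (Set.mem_range_self i)) _)⟩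
    have hg : LinearIndependent k g := by
      refine LinearIndependent.of_comp W.subtype ?_
      refine hli.comp (fun (e : Fin n → Fin (N / n + 1)) i => (e i : ℕ)) fun e e' h => ?_
      funext i
      exact Fin.ext (congrFun h i)
    simpa using hg.fintype_card_le_finrank
  rw [mul_sub, mul_one, mul_div_assoc', le_div_iff₀ hlogN, sub_mul, div_mul_cancel₀ _ hlogN.ne',
    ← mul_sub]
  rcases Nat.eq_zero_or_pos n with rfl | hn
  · simpa using Real.log_natCast_nonneg _
  have hn' : (0 : ℝ) < n := by exact_mod_cast hn
  rw [← Real.log_div (by positivity) hn'.ne', ← Real.log_pow]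
  refine Real.log_le_log (by positivity) ?_
  calc ((N : ℝ) / n) ^ n ≤ ((N / n + 1 : ℕ) : ℝ) ^ n := by
        gcongr
        rw [div_le_iff₀ hn']
        have := Nat.lt_div_mul_add hn (a := N)
        have h2 : N ≤ (N / n + 1) * n := by rw [add_mul, one_mul]; omega
        exact_mod_cast h2
    _ ≤ Module.finrank k W := by exact_mod_cast hcard

theorem GKdim_eq (hz : Algebra.adjoin k (Set.range z) = ⊤) (hw : ∀ i, 1 ≤ w i)
    (hc : ∀ i j, z i * z j - z j * z i ∈ wordFiltration k z w (w i + w j))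
    (hli : LinearIndependent k (orderedMonomial z)) : GKdim k B = (n : EReal) :=
  le_antisymm (GKdim_le hz hw hc) (le_GKdim hli)

end Growth

/-! ### Ordered monomials in primitive elements -/

section PrimitiveMonomials

theorem List.prod_ofFn_sum {R : Type*} [Semiring R] {n : ℕ} (t : Fin n → Finset ℕ)
    (F : Fin n → ℕ → R) :
    (List.ofFn fun i => ∑ j ∈ t i, F i j).prod =
      ∑ p ∈ Fintype.piFinset t, (List.ofFn fun i => F i (p i)).prod := by
  induction n with
  | zero => simp
  | succ n ih =>
    rw [List.ofFn_succ, List.prod_cons, ih, Finset.sum_mul_sum, ← Finset.sum_product']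
    refine Finset.sum_bij' (fun q _ => Fin.cons q.1 q.2) (fun p _ => (p 0, Fin.tail p))
      ?_ ?_ ?_ ?_ ?_
    · intro q hq
      simp only [Finset.mem_product, Fintype.mem_piFinset] at hq ⊢
      exact fun i => Fin.cases hq.1 hq.2 i
    · intro p hp
      simp only [Finset.mem_product, Fintype.mem_piFinset] at hp ⊢
      exact ⟨hp 0, fun i => hp i.succ⟩
    · simp
    · simp
    · simp [List.ofFn_succ]

variable {k : Type*} {U : Type*} [Field k] [Ring U] [Algebra k U] {n : ℕ} {z : Fin n → U}

theorem List.prod_ofFn_smul_tmul (c : Fin n → k) (u v : Fin n → U) :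
    (List.ofFn fun i => c i • (u i ⊗ₜ[k] v i)).prod =
      (∏ i, c i) • ((List.ofFn u).prod ⊗ₜ[k] (List.ofFn v).prod) := by
  induction n with
  | zero => simp [Algebra.TensorProduct.one_def]
  | succ n ih =>
    simp only [List.ofFn_succ, List.prod_cons, Fin.prod_univ_succ]
    rw [ih (fun i => c i.succ) (fun i => u i.succ) (fun i => v i.succ), smul_mul_smul_comm,
      Algebra.TensorProduct.tmul_mul_tmul]

theorem orderedMonomial_zero : orderedMonomial z 0 = 1 := by
  rw [orderedMonomial]
  refine List.prod_eq_one fun u hu => ?_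
  obtain ⟨i, rfl⟩ := (List.mem_ofFn' _ _).1 hu
  simp

/-- The comultiplication of an ordered monomial in primitive elements. -/
theorem map_orderedMonomial_of_primitive (Δ : U →ₐ[k] U ⊗[k] U)
    (hΔ : ∀ i, Δ (z i) = z i ⊗ₜ 1 + 1 ⊗ₜ z i) (e : Fin n → ℕ) :
    Δ (orderedMonomial z e) = ∑ p ∈ Fintype.piFinset fun i => Finset.range (e i + 1),
      (∏ i, ((e i).choose (p i) : k)) • (orderedMonomial z p ⊗ₜ[k] orderedMonomial z (e - p)) := by
  have h1 : ∀ i, Δ (z i ^ e i) = ∑ j ∈ Finset.range (e i + 1),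
      ((e i).choose j : k) • ((z i ^ j) ⊗ₜ[k] (z i ^ (e i - j))) := by
    intro i
    have hc : Commute (z i ⊗ₜ[k] (1 : U)) (1 ⊗ₜ z i) := by simp [Commute, SemiconjBy]
    rw [map_pow, hΔ, hc.add_pow]
    refine Finset.sum_congr rfl fun j _ => ?_
    simp [Algebra.TensorProduct.tmul_pow, ← Nat.cast_comm, ← nsmul_eq_mul, Nat.cast_smul_eq_nsmul]
  rw [orderedMonomial, map_list_prod, List.map_ofFn]
  simp only [Function.comp_def, h1]
  rw [List.prod_ofFn_sum]
  refine Finset.sum_congr rfl fun p _ => ?_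
  rw [List.prod_ofFn_smul_tmul]
  rfl

/-- Dual functionals of a linearly independent family. -/
theorem LinearIndepOn.exists_dual {ι V : Type*} [AddCommGroup V] [Module k V] [DecidableEq ι]
    {v : ι → V} {s : Set ι} (h : LinearIndepOn k v s) {f : ι} (hf : f ∈ s) :
    ∃ ξ : V →ₗ[k] k, ∀ g ∈ s, ξ (v g) = if g = f then 1 else 0 := by
  classical
  have h' : LinearIndependent k fun i : s => v i := h
  obtain ⟨ξ, hξ⟩ := LinearMap.exists_extend (Finsupp.lapply (R := k) (⟨f, hf⟩ : s) ∘ₗ h'.repr)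
  refine ⟨ξ, fun g hg => ?_⟩
  have := LinearMap.congr_fun hξ ⟨v g, Submodule.subset_span ⟨⟨g, hg⟩, rfl⟩⟩
  rw [LinearMap.comp_apply, LinearMap.comp_apply, h'.repr_eq_single ⟨g, hg⟩ _ rfl] at this
  simpa [Finsupp.single_apply] using this

/-- Assume that the ordered monomials of degree at most `m` are linearly independent. A
linear relation between those of degree at most `m + 1` involves none of degree at least two:
pairing its comultiplication with functionals dual to `z ^ f` and `z ^ g` isolates the coefficient
of `z ^ (f + g)`. -/
theorem coeff_eq_zero_of_relation [CharZero k] (Δ : U →ₐ[k] U ⊗[k] U)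
    (hΔ : ∀ i, Δ (z i) = z i ⊗ₜ 1 + 1 ⊗ₜ z i) {m : ℕ}
    (hm : LinearIndepOn k (orderedMonomial z) {e | ∑ i, e i ≤ m}) {l : (Fin n → ℕ) →₀ k}
    (hl : l ∈ Finsupp.supported k k {e : Fin n → ℕ | ∑ i, e i ≤ m + 1})
    (hrel : Finsupp.linearCombination k (orderedMonomial z) l = 0) {f g : Fin n → ℕ} (hf : f ≠ 0)
    (hg : g ≠ 0) : l (f + g) = 0 := by
  by_contra hne
  have hpos : ∀ {e : Fin n → ℕ}, e ≠ 0 → 0 < ∑ i, e i := fun {e} he => by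
    obtain ⟨i, hi⟩ := Function.ne_iff.1 he
    exact (Nat.pos_of_ne_zero hi).trans_le (Finset.single_le_sum (fun _ _ => Nat.zero_le _)
      (Finset.mem_univ i))
  have hfg : ∑ i, f i + ∑ i, g i ≤ m + 1 := by
    simpa [Finset.sum_add_distrib] using hl (Finsupp.mem_support_iff.2 hne)
  have hf0 := hpos hf
  have hg0 := hpos hg
  obtain ⟨ξ, hξ⟩ := hm.exists_dual (f := f) (by simp only [Set.mem_ofPred_eq]; omega)
  obtain ⟨η, hη⟩ := hm.exists_dual (f := g) (by simp only [Set.mem_ofPred_eq]; omega)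
  let Ψ : U →ₗ[k] k := LinearMap.mul' k k ∘ₗ TensorProduct.map ξ η ∘ₗ Δ.toLinearMap
  -- the terms `z ^ e ⊗ 1` and `1 ⊗ z ^ e` may have degree `m + 1` on one side, where `ξ` and `η`
  -- are not controlled, but then the other functional vanishes
  have hpair : ∀ e p : Fin n → ℕ, ∑ i, e i ≤ m + 1 → (∀ i, p i ≤ e i) →
      ξ (orderedMonomial z p) * η (orderedMonomial z (e - p)) =
        if e = f + g ∧ p = f then 1 else 0 := by
    intro e p he hp
    have hsum : ∑ i, p i + ∑ i, (e - p) i = ∑ i, e i := by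
      rw [← Finset.sum_add_distrib]
      exact Finset.sum_congr rfl fun i _ => Nat.add_sub_cancel' (hp i)
    have hpe : p + (e - p) = e := funext fun i => Nat.add_sub_cancel' (hp i)
    have h0 : (0 : Fin n → ℕ) ∈ {e : Fin n → ℕ | ∑ i, e i ≤ m} := by simp
    by_cases h1 : p = 0
    · rw [h1, hξ 0 h0, if_neg hf.symm, zero_mul, if_neg fun h => hf.symm h.2]
    by_cases h2 : e - p = 0
    · rw [h2, hη 0 h0, if_neg hg.symm, mul_zero, if_neg]
      rintro ⟨rfl, rfl⟩
      exact hg (by simpa using h2)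
    have h1' := hpos h1
    have h2' := hpos h2
    rw [hξ p (by simp only [Set.mem_ofPred_eq]; omega),
      hη (e - p) (by simp only [Set.mem_ofPred_eq]; omega), ite_zero_mul_ite_zero, one_mul]
    refine if_congr ⟨?_, ?_⟩ rfl rfl
    · rintro ⟨rfl, rfl⟩
      exact ⟨hpe.symm, rfl⟩
    · rintro ⟨rfl, rfl⟩
      exact ⟨rfl, by simp⟩
  -- hence only the exponent `f + g` contributes to the pairing of the relation
  have hΨ : ∀ e ∈ l.support, Ψ (orderedMonomial z e) =
      if e = f + g then ∏ i, ((e i).choose (f i) : k) else 0 := by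
    intro e he
    have he' : ∑ i, e i ≤ m + 1 := hl he
    have : Ψ (orderedMonomial z e) = ∑ p ∈ Fintype.piFinset fun i => Finset.range (e i + 1),
        if e = f + g ∧ p = f then ∏ i, ((e i).choose (p i) : k) else 0 := by
      simp only [Ψ, LinearMap.comp_apply, AlgHom.toLinearMap_apply,
        map_orderedMonomial_of_primitive Δ hΔ, map_sum, map_smul, TensorProduct.map_tmul,
        LinearMap.mul'_apply]
      refine Finset.sum_congr rfl fun p hp => ?_
      rw [hpair e p he' fun i =>
        Nat.lt_succ_iff.1 (Finset.mem_range.1 (Fintype.mem_piFinset.1 hp i))]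
      simp
    rw [this]
    split_ifs with h
    · subst h
      rw [Finset.sum_eq_single f]
      · simp
      · intro p _ hp
        simp [hp]
      · intro hf'
        simp at hf'
    · simp [h]
  have := congrArg Ψ hrel
  rw [Finsupp.linearCombination_apply, map_finsuppSum, map_zero, Finsupp.sum,
    Finset.sum_eq_single (f + g)] at this
  · rw [map_smul, hΨ _ (Finsupp.mem_support_iff.2 hne), if_pos rfl, smul_eq_mul, mul_eq_zero,
      Finset.prod_eq_zero_iff] at this
    obtain ⟨i, -, hi⟩ := this.resolve_left hne
    exact (Nat.choose_pos (Nat.le_add_right (f i) (g i))).ne' (Nat.cast_eq_zero.1 hi)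
  · intro e he hne'
    rw [map_smul, hΨ e he, if_neg hne', smul_zero]
  · intro h
    rw [Finsupp.notMem_support_iff.1 h, zero_smul, map_zero]

theorem orderedMonomial_single (i : Fin n) : orderedMonomial z (Pi.single i 1) = z i := by
  have h := orderedWord_count_perm [i]
  rw [List.singleton_perm] at h
  have he : (fun j => [i].count j) = Pi.single i 1 := by
    funext j
    rcases eq_or_ne i j with rfl | hij
    · simp
    · simp [hij, hij.symm]
  rw [← prod_orderedWord, ← he, ← h]
  simp

/-- In characteristic zero, ordered monomials in primitive elements are linearly independent as soon
as `1` and these elements are. -/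
theorem linearIndependent_orderedMonomial_of_primitive [CharZero k] (Δ : U →ₐ[k] U ⊗[k] U)
    (hΔ : ∀ i, Δ (z i) = z i ⊗ₜ 1 + 1 ⊗ₜ z i)
    (hz : LinearIndependent k fun o : Option (Fin n) => o.elim 1 z) :
    LinearIndependent k (orderedMonomial z) := by
  have h1 : LinearIndepOn k (orderedMonomial z) {e | ∑ i, e i ≤ 1} := by
    let τ : Option (Fin n) → Fin n → ℕ := fun o => o.elim 0 fun i => Pi.single i 1
    have hτ : orderedMonomial z ∘ τ = fun o => o.elim 1 z := by
      funext o
      cases o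
      exacts [orderedMonomial_zero, orderedMonomial_single _]
    have hli : LinearIndependent k (orderedMonomial z ∘ τ) := hτ ▸ hz
    have hinj : Function.Injective τ := hli.injective.of_comp
    refine ((linearIndepOn_range_iff hinj _).2 hli).mono fun e he => ?_
    by_cases h0 : e = 0
    · exact ⟨none, h0.symm⟩
    obtain ⟨i, hi⟩ := Function.ne_iff.1 h0
    -- an exponent vector `e ≠ 0` of degree at most one is a unit vector
    refine ⟨some i, funext fun j => ?_⟩
    simp only [Set.mem_ofPred_eq] at he
    rw [← Finset.add_sum_erase _ _ (Finset.mem_univ i)] at he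
    have hi' : e i ≠ 0 := hi
    rcases eq_or_ne j i with rfl | hij
    · simp only [τ, Option.elim_some, Pi.single_eq_same]
      omega
    · have := Finset.single_le_sum (f := e) (fun _ _ => Nat.zero_le _)
        (Finset.mem_erase.2 ⟨hij, Finset.mem_univ j⟩)
      simp only [τ, Option.elim_some, Pi.single_eq_of_ne hij]
      omega
  have hall : ∀ m, LinearIndepOn k (orderedMonomial z) {e | ∑ i, e i ≤ m + 1} := by
    intro m
    induction m with
    | zero => exact h1
    | succ m ih =>
      rw [linearIndepOn_iff]
      intro l hl hrel
      refine linearIndepOn_iff.1 h1 l ?_ hrel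
      intro e he
      by_contra hlt
      simp only [Set.mem_ofPred_eq, not_le] at hlt
      obtain ⟨i, -, hi⟩ : ∃ i ∈ Finset.univ, e i ≠ 0 :=
        Finset.exists_ne_zero_of_sum_ne_zero (by omega)
      have hle : Pi.single i 1 ≤ e := by
        intro j
        rcases eq_or_ne j i with rfl | hij
        · simpa using Nat.one_le_iff_ne_zero.2 hi
        · simp [hij]
      have hsplit : Pi.single i 1 + (e - Pi.single i 1) = e := add_tsub_cancel_of_le hle
      refine Finsupp.mem_support_iff.1 he (hsplit ▸
        coeff_eq_zero_of_relation Δ hΔ ih hl hrel (f := Pi.single i 1) (g := e - Pi.single i 1)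
          ?_ ?_)
      · simp
      · intro h
        rw [h, add_zero] at hsplit
        rw [← hsplit] at hlt
        simp at hlt
  rw [linearIndependent_iff]
  intro l hrel
  refine linearIndepOn_iff.1 (hall (l.support.sup fun e => ∑ i, e i)) l (fun e he => ?_) hrel
  exact (Finset.le_sup (f := fun e : Fin n → ℕ => ∑ i, e i) he).trans (Nat.le_succ _)

end PrimitiveMonomials

/-! ### A faithful representation and the embedding of `UM(A)` -/

section OrderedMonomials

variable {B : Type*} [Ring B] {m n : ℕ}

theorem orderedMonomial_append {u : Fin m → B} {v : Fin n → B} (e : Fin m → ℕ) (f : Fin n → ℕ) :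
    orderedMonomial (Fin.append u v) (Fin.append e f) =
      orderedMonomial u e * orderedMonomial v f := by
  simp [orderedMonomial, List.ofFn_add]

theorem orderedMonomial_succ {u : Fin (n + 1) → B} (e : Fin (n + 1) → ℕ) :
    orderedMonomial u e = u 0 ^ e 0 * orderedMonomial (Fin.tail u) (Fin.tail e) := by
  simp [orderedMonomial, List.ofFn_succ, Fin.tail]

theorem commute_orderedMonomial {c : B} {u : Fin n → B} (hc : ∀ i, Commute c (u i))
    (e : Fin n → ℕ) : Commute c (orderedMonomial u e) := by
  refine Commute.list_prod_right _ _ fun v hv => ?_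
  obtain ⟨i, rfl⟩ := (List.mem_ofFn' _ _).1 hv
  exact (hc i).pow_right _

theorem orderedMonomial_central_mul {c : B} {u : Fin n → B} (hc : ∀ i, Commute c (u i))
    (e : Fin n → ℕ) :
    orderedMonomial (fun i => c * u i) e = c ^ (∑ i, e i) * orderedMonomial u e := by
  induction n with
  | zero => simp [orderedMonomial]
  | succ n ih =>
    rw [orderedMonomial_succ, orderedMonomial_succ, Fin.sum_univ_succ, pow_add]
    have := ih (u := Fin.tail u) (fun i => hc i.succ) (Fin.tail e)
    change (c * u 0) ^ e 0 * orderedMonomial (fun i => c * Fin.tail u i) (Fin.tail e) =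
      c ^ e 0 * c ^ (∑ i, Fin.tail e i) * _
    rw [this, (hc 0).mul_pow, mul_assoc, mul_assoc, ← mul_assoc (u 0 ^ e 0),
      ← ((hc 0).pow_pow _ _).eq, mul_assoc]

theorem map_orderedMonomial {k : Type*} [Field k] {C : Type*} [Ring C] [Algebra k B] [Algebra k C]
    (Φ : B →ₐ[k] C) (u : Fin n → B) (e : Fin n → ℕ) :
    Φ (orderedMonomial u e) = orderedMonomial (fun i => Φ (u i)) e := by
  simp [orderedMonomial, map_list_prod, List.map_ofFn, Function.comp_def]

end OrderedMonomials

section Envelope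

attribute [local instance 100] LieRing.ofAssociativeRing

open UniversalEnvelopingAlgebra

variable {k : Type*} [Field k] {E : Type*} [Ring E] [Algebra k E]

theorem UniversalEnvelopingAlgebra.ι_mul_ι {a c e : E} (h : a * c = c * a + e) :
    ι k a * ι k c = ι k c * ι k a + ι k e := by
  have : ⁅a, c⁆ = e := by rw [Ring.lie_def, h]; abel
  rw [← this, LieHom.map_lie, Ring.lie_def]
  abel

variable (k E) in
/-- The comultiplication of the enveloping algebra, for which the elements of the Lie algebra are
primitive. -/
def UniversalEnvelopingAlgebra.comulHom : UniversalEnvelopingAlgebra k E →ₐ[k]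
    UniversalEnvelopingAlgebra k E ⊗[k] UniversalEnvelopingAlgebra k E :=
  lift k
    { toFun a := ι k a ⊗ₜ 1 + 1 ⊗ₜ ι k a
      map_add' a c := by
        simp only [map_add, TensorProduct.add_tmul, TensorProduct.tmul_add]
        abel
      map_smul' q a := by
        simp [TensorProduct.smul_tmul']
      map_lie' {a c} := by
        rw [LieHom.map_lie]
        simp only [Ring.lie_def, TensorProduct.sub_tmul, TensorProduct.tmul_sub,
          mul_add, add_mul, Algebra.TensorProduct.tmul_mul_tmul, one_mul, mul_one]
        abel }

theorem UniversalEnvelopingAlgebra.comulHom_ι (a : E) :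
    comulHom k E (ι k a) = ι k a ⊗ₜ 1 + 1 ⊗ₜ ι k a :=
  lift_ι_apply k _ a

/-- In the enveloping algebra of an associative algebra with the commutator bracket, the ordered
monomials in linearly independent elements of the Lie algebra are linearly independent. The identity
map shows that `ι` is injective, and the zero map that `1` is not in its range. -/
theorem UniversalEnvelopingAlgebra.linearIndependent_orderedMonomial [CharZero k] {n : ℕ}
    {v : Fin n → E} (hv : LinearIndependent k v) :
    LinearIndependent k (orderedMonomial fun i => ι k (v i)) := by
  refine linearIndependent_orderedMonomial_of_primitive (comulHom k E) (fun i => comulHom_ι _) ?_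
  have h1 : LinearIndependent k fun i => ι k (v i) := by
    refine LinearIndependent.of_comp (lift k (LieHom.id : E →ₗ⁅k⁆ E)).toLinearMap ?_
    have : (lift k (LieHom.id : E →ₗ⁅k⁆ E)).toLinearMap ∘ (fun i => ι k (v i)) = v :=
      funext fun i => lift_ι_apply k (LieHom.id : E →ₗ⁅k⁆ E) (v i)
    rwa [this]
  refine linearIndependent_option.2 ⟨h1, fun h => ?_⟩
  have hle : Submodule.span k (Set.range fun i => ι k (v i)) ≤
      LinearMap.ker (lift k (0 : E →ₗ⁅k⁆ k)).toLinearMap := by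
    rw [Submodule.span_le]
    rintro _ ⟨i, rfl⟩
    exact lift_ι_apply k (0 : E →ₗ⁅k⁆ k) (v i)
  have h0 : lift k (0 : E →ₗ⁅k⁆ k) 1 = 0 := hle h
  rw [map_one] at h0
  exact one_ne_zero h0

end Envelope

namespace UM

section Representation

variable {k : Type*} [Field k] {r : ℕ}

variable (k r) in
/-- The space `k ⊕ k^r ⊕ k^r ⊕ k` carrying the representation. The `x_i` map the last summand to the
first copy of `k^r` and that copy to the first summand by means of the form `A / 2`; the `x_i'` do
the same through the second copy, with the form `A / 6`. -/
abbrev RepSpace : Type _ := k × (Fin r → k) × (Fin r → k) × k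

variable (k r) in
/-- The operator representing `x_0`. -/
def opX0 : Module.End k (RepSpace k r) where
  toFun v := (v.2.2.2, 0, 0, 0)
  map_add' _ _ := by simp
  map_smul' _ _ := by simp

/-- The operator representing `x_i`. -/
def opX (A : Matrix (Fin r) (Fin r) k) (i : Fin r) : Module.End k (RepSpace k r) where
  toFun v := (1 / 2 * A.mulVec v.2.1 i, v.2.2.2 • Pi.single i 1, 0, 0)
  map_add' _ _ := by simp [Matrix.mulVec_add, mul_add, add_smul]
  map_smul' _ _ := by simp [Matrix.mulVec_smul, mul_smul, mul_left_comm]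

/-- The operator representing a second copy `x_i'` of `x_i`, which satisfies
`[x_i', x_j'] = (1/3) A_ij x_0` and for which `x_0 x_i'` plays the role of `y_i`. -/
def opX' (A : Matrix (Fin r) (Fin r) k) (i : Fin r) : Module.End k (RepSpace k r) where
  toFun v := (1 / 6 * A.mulVec v.2.2.1 i, 0, v.2.2.2 • Pi.single i 1, 0)
  map_add' _ _ := by simp [Matrix.mulVec_add, mul_add, add_smul]
  map_smul' _ _ := by simp [Matrix.mulVec_smul, mul_smul, mul_left_comm]

/-- The operator representing a matrix `M`, acting by `-Mᵀ` on both copies of `k^r`. -/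
def opM (M : Matrix (Fin r) (Fin r) k) : Module.End k (RepSpace k r) where
  toFun v := (0, -M.transpose.mulVec v.2.1, -M.transpose.mulVec v.2.2.1, 0)
  map_add' _ _ := by simp [Matrix.mulVec_add, add_comm]
  map_smul' _ _ := by simp [Matrix.mulVec_smul]

variable (v : RepSpace k r)

theorem opX0_apply : opX0 k r v = (v.2.2.2, 0, 0, 0) := rfl

theorem opX_apply (A : Matrix (Fin r) (Fin r) k) (i : Fin r) :
    opX A i v = (1 / 2 * A.mulVec v.2.1 i, v.2.2.2 • Pi.single i 1, 0, 0) := rfl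

theorem opX'_apply (A : Matrix (Fin r) (Fin r) k) (i : Fin r) :
    opX' A i v = (1 / 6 * A.mulVec v.2.2.1 i, 0, v.2.2.2 • Pi.single i 1, 0) := rfl

theorem opM_apply (M : Matrix (Fin r) (Fin r) k) :
    opM M v = (0, -M.transpose.mulVec v.2.1, -M.transpose.mulVec v.2.2.1, 0) := rfl

theorem opM_add (M N : Matrix (Fin r) (Fin r) k) : opM (M + N) = opM M + opM N := by
  refine LinearMap.ext fun v => ?_
  simp [opM_apply, Matrix.add_mulVec, add_comm]

theorem opM_smul (c : k) (M : Matrix (Fin r) (Fin r) k) : opM (c • M) = c • opM M := by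
  refine LinearMap.ext fun v => ?_
  simp [opM_apply, Matrix.smul_mulVec]

theorem opX0_mul_opX (A : Matrix (Fin r) (Fin r) k) (i : Fin r) :
    opX0 k r * opX A i = opX A i * opX0 k r := by
  refine LinearMap.ext fun v => ?_
  simp [opX0_apply, opX_apply]

theorem opX0_mul_opX' (A : Matrix (Fin r) (Fin r) k) (i : Fin r) :
    opX0 k r * opX' A i = opX' A i * opX0 k r := by
  refine LinearMap.ext fun v => ?_
  simp [opX0_apply, opX'_apply]

theorem opX0_mul_opM (M : Matrix (Fin r) (Fin r) k) :
    opX0 k r * opM M = opM M * opX0 k r := by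
  refine LinearMap.ext fun v => ?_
  simp [opX0_apply, opM_apply]

theorem opX_mul_opX' (A : Matrix (Fin r) (Fin r) k) (i j : Fin r) :
    opX A i * opX' A j = opX' A j * opX A i := by
  refine LinearMap.ext fun v => ?_
  simp [opX_apply, opX'_apply]

theorem opX_mul_opX [CharZero k] {A : Matrix (Fin r) (Fin r) k} (hA : A.transpose = -A)
    (i j : Fin r) : opX A i * opX A j = opX A j * opX A i + A i j • opX0 k r := by
  have hji : A j i = -A i j := congrFun (congrFun hA i) j
  refine LinearMap.ext fun v => ?_
  simp [opX_apply, opX0_apply, Matrix.mulVec_smul, hji]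
  ring

theorem opX'_mul_opX' [CharZero k] {A : Matrix (Fin r) (Fin r) k} (hA : A.transpose = -A)
    (i j : Fin r) : opX' A i * opX' A j = opX' A j * opX' A i + (1 / 3 * A i j) • opX0 k r := by
  have hji : A j i = -A i j := congrFun (congrFun hA i) j
  refine LinearMap.ext fun v => ?_
  simp [opX'_apply, opX0_apply, Matrix.mulVec_smul, hji]
  ring

theorem opM_mul_opM (M N : Matrix (Fin r) (Fin r) k) :
    opM M * opM N = opM N * opM M + opM (M * N - N * M) := by
  refine LinearMap.ext fun v => ?_
  simp [opM_apply, Matrix.mulVec_neg, Matrix.mulVec_mulVec, Matrix.sub_mulVec]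

theorem sum_smul_opX_apply (A : Matrix (Fin r) (Fin r) k) (c : Fin r → k) :
    (∑ l, c l • opX A l) v = (1 / 2 * c ⬝ᵥ A.mulVec v.2.1, v.2.2.2 • c, 0, 0) := by
  simp only [LinearMap.sum_apply, LinearMap.smul_apply, opX_apply]
  refine Prod.ext ?_ (Prod.ext (funext fun j => ?_) (Prod.ext ?_ ?_))
  · simp [Prod.fst_sum, dotProduct, Finset.mul_sum, mul_left_comm]
  · simp [Prod.fst_sum, Prod.snd_sum, Pi.single_apply, mul_comm]
  · simp [Prod.snd_sum]
  · simp [Prod.snd_sum]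

theorem sum_smul_opX'_apply (A : Matrix (Fin r) (Fin r) k) (c : Fin r → k) :
    (∑ l, c l • opX' A l) v = (1 / 6 * c ⬝ᵥ A.mulVec v.2.2.1, 0, v.2.2.2 • c, 0) := by
  simp only [LinearMap.sum_apply, LinearMap.smul_apply, opX'_apply]
  refine Prod.ext ?_ (Prod.ext ?_ (Prod.ext (funext fun j => ?_) ?_))
  · simp [Prod.fst_sum, dotProduct, Finset.mul_sum, mul_left_comm]
  · simp [Prod.fst_sum, Prod.snd_sum]
  · simp [Prod.fst_sum, Prod.snd_sum, Pi.single_apply, mul_comm]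
  · simp [Prod.snd_sum]

/-- The condition defining `so(A)` says that `-Mᵀ` is skew for the form `A`. -/
theorem row_dotProduct_mulVec {A : Matrix (Fin r) (Fin r) k} {M : Matrix (Fin r) (Fin r) k}
    (hM : M * A = -(A * M.transpose)) (i : Fin r) (u : Fin r → k) :
    M i ⬝ᵥ A.mulVec u = -A.mulVec (M.transpose.mulVec u) i := by
  change M.mulVec (A.mulVec u) i = _
  rw [Matrix.mulVec_mulVec, Matrix.mulVec_mulVec, hM, Matrix.neg_mulVec, Pi.neg_apply]

theorem opX_mul_opM {A : Matrix (Fin r) (Fin r) k} {M : Matrix (Fin r) (Fin r) k}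
    (hM : M * A = -(A * M.transpose)) (i : Fin r) :
    opX A i * opM M = opM M * opX A i + ∑ l, M i l • opX A l := by
  refine LinearMap.ext fun v => ?_
  rw [LinearMap.add_apply, sum_smul_opX_apply, row_dotProduct_mulVec hM]
  have : M.transpose.col i = M i := rfl
  simp [opX_apply, opM_apply, Matrix.mulVec_neg, Matrix.mulVec_smul, this]

theorem opX'_mul_opM {A : Matrix (Fin r) (Fin r) k} {M : Matrix (Fin r) (Fin r) k}
    (hM : M * A = -(A * M.transpose)) (i : Fin r) :
    opX' A i * opM M = opM M * opX' A i + ∑ l, M i l • opX' A l := by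
  refine LinearMap.ext fun v => ?_
  rw [LinearMap.add_apply, sum_smul_opX'_apply, row_dotProduct_mulVec hM]
  have : M.transpose.col i = M i := rfl
  simp [opX'_apply, opM_apply, Matrix.mulVec_neg, Matrix.mulVec_smul, this]

variable (k r) in
/-- `opM` as a linear map. -/
def opMₗ : Matrix (Fin r) (Fin r) k →ₗ[k] Module.End k (RepSpace k r) where
  toFun := opM
  map_add' := opM_add
  map_smul' := opM_smul

theorem opM_injective : Function.Injective (opMₗ k r) := by
  refine (injective_iff_map_eq_zero _).2 fun M hM => ?_
  refine Matrix.transpose_injective (Matrix.mulVec_injective (funext fun u => ?_))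
  have h : opM M (0, u, 0, 0) = 0 := LinearMap.congr_fun hM (0, u, 0, 0)
  simpa [opM_apply] using h

/-- The representing operators of `x_0, ..., x_r`. -/
def opXs (A : Matrix (Fin r) (Fin r) k) : Fin (r + 1) → Module.End k (RepSpace k r) :=
  Fin.cons (opX0 k r) (opX A)

variable {d : ℕ}

/-- The representing operators of `x_0, ..., x_r, X_1, ..., X_d, x_1', ..., x_r'`. -/
noncomputable def opGens (A : Matrix (Fin r) (Fin r) k) (b : Module.Basis (Fin d) k (soLie A)) :
    Fin (r + 1 + d + r) → Module.End k (RepSpace k r) :=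
  Fin.append (Fin.append (opXs A) fun m => opM (b m).1) (opX' A)

theorem linearIndependent_opGens (A : Matrix (Fin r) (Fin r) k)
    (b : Module.Basis (Fin d) k (soLie A)) : LinearIndependent k (opGens A b) := by
  rw [Fintype.linearIndependent_iff]
  intro c hc
  have hsum : ∑ m, c (Fin.castAdd r (Fin.natAdd (r + 1) m)) • opM (b m).1 =
      opM (∑ m, c (Fin.castAdd r (Fin.natAdd (r + 1) m)) • (b m).1) := by
    change _ = opMₗ k r _
    rw [map_sum]
    simp only [map_smul]
    rfl
  simp only [Fin.sum_univ_add, Fin.sum_univ_succ, opGens, opXs, Fin.append_left, Fin.append_right,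
    Fin.cons_zero, Fin.cons_succ, hsum] at hc
  -- evaluation on the last summand isolates the coefficients of `x_0`, `x_i` and `x_i'`
  have happ := LinearMap.congr_fun hc (0, 0, 0, 1)
  simp only [LinearMap.add_apply, sum_smul_opX_apply, sum_smul_opX'_apply] at happ
  simp [opX0_apply, opM_apply] at happ
  obtain ⟨h0, hx, hx'⟩ := happ
  have hx1 := fun i => congrFun hx i
  have hx1' := fun i => congrFun hx' i
  simp only [Pi.zero_apply] at hx1 hx1'
  simp only [h0, hx1, hx1', zero_smul, Finset.sum_const_zero, add_zero, zero_add] at hc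
  have hM := opM_injective (hc.trans (map_zero (opMₗ k r)).symm)
  have hX : ∀ m, c (Fin.castAdd r (Fin.natAdd (r + 1) m)) = 0 := by
    refine Fintype.linearIndependent_iff.1 b.linearIndependent _ (Subtype.ext ?_)
    simpa using hM
  intro i
  induction i using Fin.addCases with
  | left i =>
    induction i using Fin.addCases with
    | left i =>
      induction i using Fin.cases with
      | zero => exact h0
      | succ i => exact hx1 i
    | right i => exact hX i
  | right i => exact hx1' i

end Representation

end UM

/-! ### Linear independence of the ordered monomials of `UM(A)` -/

section Embedding

attribute [local instance 100] LieRing.ofAssociativeRing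

variable {k : Type*} [Field k] {r d : ℕ} {A : Matrix (Fin r) (Fin r) k}
  {b : Module.Basis (Fin d) k (soLie A)}

namespace UM

open UniversalEnvelopingAlgebra

variable (k r) in
/-- The enveloping algebra of the Lie algebra of all operators on the representation space. -/
abbrev Envelope : Type _ := UniversalEnvelopingAlgebra k (Module.End k (RepSpace k r))

theorem opXs_zero : opXs A 0 = opX0 k r := rfl

theorem opXs_succ (i : Fin r) : opXs A i.succ = opX A i := rfl

theorem ι_commute {a c : Module.End k (RepSpace k r)} (h : a * c = c * a) :
    ι k a * ι k c = ι k c * ι k a := by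
  have := ι_mul_ι (k := k) (a := a) (c := c) (e := 0) (by rwa [add_zero])
  rwa [map_zero, add_zero] at this

theorem ι_sum_smul {m : ℕ} (c : Fin m → k) (u : Fin m → Module.End k (RepSpace k r)) :
    ι k (∑ l, c l • u l) = ∑ l, c l • ι k (u l) := by
  change (ι k : Module.End k (RepSpace k r) →ₗ⁅k⁆ Envelope k r).toLinearMap _ = _
  rw [map_sum]
  simp only [map_smul]
  rfl

variable (b) in
/-- In the enveloping algebra, `x_i`, `X_j` and `x_0 x_i'` satisfy the relations of `UM(A)`. -/
theorem isUMFamily_envelope [CharZero k] (hA : A.transpose = -A) :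
    IsUMFamily A b (B := Envelope k r) (fun i => ι k (opXs A i)) (fun m => ι k (opM (b m).1))
      (fun i => ι k (opX0 k r) * ι k (opX' A i)) where
  x0x i := by
    refine ι_commute ?_
    refine Fin.cases rfl (fun i => ?_) i
    exact opX0_mul_opX A i
  x0X m := ι_commute (opX0_mul_opM _)
  x0y i := by
    simp only [opXs_zero]
    rw [mul_assoc, ι_commute (opX0_mul_opX' A i)]
  xx i j := by
    simp only [opXs_succ, opXs_zero]
    rw [ι_mul_ι (opX_mul_opX hA i j), map_smul]
  yy i j := by
    simp only [opXs_zero]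
    have h1 := ι_commute (opX0_mul_opX' A i)
    have h2 := ι_commute (opX0_mul_opX' A j)
    have h3 := ι_mul_ι (k := k) (opX'_mul_opX' hA i j)
    rw [map_smul] at h3
    generalize ι k (opX0 k r) = t at *
    generalize ι k (opX' A i) = u at *
    generalize ι k (opX' A j) = v at *
    calc t * u * (t * v) = t * t * (u * v) := by rw [mul_assoc, ← mul_assoc u, ← h1]; noncomm_ring
      _ = t * t * (v * u) + (1 / 3 * A i j) • t ^ 3 := by
        rw [h3, mul_add, mul_smul_comm]; noncomm_ring
      _ = t * v * (t * u) + _ := by rw [mul_assoc t v, ← mul_assoc v, ← h2]; noncomm_ring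
  xy i j := by
    simp only [opXs_succ]
    rw [← mul_assoc, ← ι_commute (opX0_mul_opX A i), mul_assoc, mul_assoc,
      ι_commute (opX_mul_opX' A i j)]
  xM i m := by
    simp only [opXs_succ]
    rw [ι_mul_ι (opX_mul_opM (b m).2 i), ι_sum_smul]
  yM i m := by
    have h := ι_mul_ι (k := k) (opX'_mul_opM (b m).2 i)
    rw [mul_assoc, h, mul_add, ← mul_assoc, ι_commute (opX0_mul_opM _), ι_sum_smul, Finset.mul_sum,
      mul_assoc]
    simp only [mul_smul_comm]
  MN m n := by
    have h := ι_mul_ι (k := k) (opM_mul_opM (b m).1 (b n).1)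
    rw [h]
    congr 1
    have h2 : (b m).1 * (b n).1 - (b n).1 * (b m).1 =
        ∑ l, b.repr ⁅b m, b n⁆ l • (b l).1 := by
      have h := congrArg Subtype.val (b.sum_repr ⁅b m, b n⁆)
      rw [LieSubalgebra.coe_bracket, Ring.lie_def] at h
      rw [← h]
      change (soLie A).toSubmodule.subtype _ = _
      rw [map_sum]
      rfl
    have h3 : opM ((b m).1 * (b n).1 - (b n).1 * (b m).1) =
        ∑ l, b.repr ⁅b m, b n⁆ l • opM (b l).1 := by
      rw [h2]
      change opMₗ k r _ = _
      rw [map_sum]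
      simp only [map_smul]
      rfl
    rw [h3, ι_sum_smul]

variable (b) in
/-- The ordered monomials of `UM(A)` are linearly independent: the substitution `y_i ↦ x_0 x_i'`
maps them to pairwise distinct ordered monomials in an enveloping algebra. -/
theorem linearIndependent_orderedMonomial [CharZero k] (hA : A.transpose = -A) :
    LinearIndependent k (orderedMonomial (gens A b)) := by
  let Φ := lift (isUMFamily_envelope b hA)
  -- exponents of the image of a monomial: each `y_i` contributes one factor `x_0`
  let part₁ : (Fin (r + 1 + d + r) → ℕ) → Fin (r + 1) → ℕ :=
    fun e i => e (Fin.castAdd r (Fin.castAdd d i))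
  let part₂ : (Fin (r + 1 + d + r) → ℕ) → Fin d → ℕ :=
    fun e i => e (Fin.castAdd r (Fin.natAdd (r + 1) i))
  let part₃ : (Fin (r + 1 + d + r) → ℕ) → Fin r → ℕ := fun e i => e (Fin.natAdd (r + 1 + d) i)
  have hparts : ∀ e, e = Fin.append (Fin.append (part₁ e) (part₂ e)) (part₃ e) := by
    intro e
    funext i
    induction i using Fin.addCases with
    | left i => induction i using Fin.addCases <;> simp [part₁, part₂]
    | right i => simp [part₃]
  let σ : (Fin (r + 1 + d + r) → ℕ) → Fin (r + 1 + d + r) → ℕ := fun e =>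
    Fin.append (Fin.append (Fin.cons (part₁ e 0 + ∑ i, part₃ e i) (Fin.tail (part₁ e))) (part₂ e))
      (part₃ e)
  have hσ : Function.Injective σ := by
    intro e e' h
    have h3 : part₃ e = part₃ e' := by
      funext i
      simpa [σ] using congrFun h (Fin.natAdd (r + 1 + d) i)
    have h2 : part₂ e = part₂ e' := by
      funext i
      simpa [σ] using congrFun h (Fin.castAdd r (Fin.natAdd (r + 1) i))
    have h1 : part₁ e = part₁ e' := by
      funext i
      have := congrFun h (Fin.castAdd r (Fin.castAdd d i))
      refine Fin.cases (fun this => ?_) (fun i this => ?_) i this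
      · simpa [σ, h3] using this
      · simpa [σ, Fin.tail] using this
    rw [hparts e, hparts e', h1, h2, h3]
  have hΦ : ∀ e, Φ (orderedMonomial (gens A b) e) =
      orderedMonomial (fun i => ι k (opGens A b i)) (σ e) := by
    intro e
    have hx : (fun i => Φ (x A b i)) = fun i => ι k (opXs A i) := funext fun i => lift_x _ i
    have hX : (fun i => Φ (X A b i)) = fun i => ι k (opM (b i).1) := funext fun i => lift_X _ i
    have hy : (fun i => Φ (y A b i)) = fun i => ι k (opX0 k r) * ι k (opX' A i) :=
      funext fun i => lift_y _ i
    have hgens : (fun i => ι k (opGens A b i)) = Fin.append (Fin.append (fun i => ι k (opXs A i))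
        fun i => ι k (opM (b i).1)) fun i => ι k (opX' A i) := by
      funext i
      induction i using Fin.addCases with
      | left i => induction i using Fin.addCases <;> simp [opGens]
      | right i => simp [opGens]
    rw [hgens]
    conv_lhs => rw [hparts e]
    simp only [gens, σ]
    rw [orderedMonomial_append, orderedMonomial_append, orderedMonomial_append,
      orderedMonomial_append, map_mul, map_mul, map_orderedMonomial, map_orderedMonomial,
      map_orderedMonomial, hx, hX, hy,
      orderedMonomial_central_mul (fun i => ι_commute (opX0_mul_opX' A i)),
      orderedMonomial_succ, orderedMonomial_succ, Fin.cons_zero, Fin.tail_cons, pow_add]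
    have hc₁ : Commute (ι k (opX0 k r) ^ ∑ i, part₃ e i)
        (orderedMonomial (Fin.tail fun i => ι k (opXs A i)) (Fin.tail (part₁ e))) :=
      (commute_orderedMonomial (fun i => ι_commute (opX0_mul_opX A i)) _).pow_left _
    have hc₂ : Commute (ι k (opX0 k r) ^ ∑ i, part₃ e i)
        (orderedMonomial (fun i => ι k (opM (b i).1)) (part₂ e)) :=
      (commute_orderedMonomial (fun i => ι_commute (opX0_mul_opM _)) _).pow_left _
    simp only [opXs_zero, mul_assoc]
    rw [hc₁.left_comm, hc₂.left_comm]
  refine LinearIndependent.of_comp Φ.toLinearMap ?_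
  have h : LinearIndependent k ((orderedMonomial fun i => ι k (opGens A b i)) ∘ σ) :=
    (UniversalEnvelopingAlgebra.linearIndependent_orderedMonomial
    (linearIndependent_opGens A b)).comp σ hσ
  rw [show Φ.toLinearMap ∘ orderedMonomial (gens A b) = _ from funext hΦ]
  exact h

end UM

end Embedding

/-! ### The weight filtration of `UM(A)` -/

namespace UM

section Weights

variable {k : Type*} [Field k] {r d : ℕ} {A : Matrix (Fin r) (Fin r) k}
  {b : Module.Basis (Fin d) k (soLie A)}

variable (r d) in
/-- The weights of the generators: `x_i` and `X_j` have weight `1`, and `y_i` has weight `2`. With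
these weights `[y_i, y_j] = (1/3) A_ij x_0 ^ 3` has smaller weight than `y_i y_j`, and the wedge
terms in `Δ(y_i)` have the weight of `y_i`. -/
def genWeight : Fin (r + 1 + d + r) → ℕ :=
  Fin.append (Fin.append (fun _ => 1) fun _ => 1) fun _ => 2

theorem genWeight_x (i : Fin (r + 1)) : genWeight r d (Fin.castAdd r (Fin.castAdd d i)) = 1 := by
  simp [genWeight]

theorem genWeight_X (j : Fin d) : genWeight r d (Fin.castAdd r (Fin.natAdd (r + 1) j)) = 1 := by
  simp [genWeight]

theorem genWeight_y (i : Fin r) : genWeight r d (Fin.natAdd (r + 1 + d) i) = 2 := by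
  simp [genWeight]

theorem one_le_genWeight (i : Fin (r + 1 + d + r)) : 1 ≤ genWeight r d i := by
  induction i using Fin.addCases with
  | left i =>
    induction i using Fin.addCases with
    | left i => rw [genWeight_x]
    | right i => rw [genWeight_X]
  | right i => rw [genWeight_y]; exact one_le_two

variable (A b) in
/-- The weight filtration of `UM(A)`. -/
abbrev filtration (m : ℕ) : Submodule k (UM A b) := wordFiltration k (gens A b) (genWeight r d) m

theorem x_mem_filtration (i : Fin (r + 1)) : x A b i ∈ filtration A b 2 := by
  rw [← gens_x]
  exact letter_mem_wordFiltration (by rw [genWeight_x]; exact one_lt_two)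

theorem X_mem_filtration (j : Fin d) : X A b j ∈ filtration A b 2 := by
  rw [← gens_X]
  exact letter_mem_wordFiltration (by rw [genWeight_X]; exact one_lt_two)

theorem y_mem_filtration (i : Fin r) : y A b i ∈ filtration A b 3 := by
  rw [← gens_y]
  exact letter_mem_wordFiltration (by rw [genWeight_y]; exact Nat.lt_succ_self 2)

theorem commutator_x_x (i j : Fin (r + 1)) :
    x A b i * x A b j - x A b j * x A b i ∈ filtration A b 2 := by
  have h := isUMFamily A b
  refine Fin.cases ?_ (fun i => ?_) i
  · rw [h.x0x, sub_self]
    exact zero_mem _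
  refine Fin.cases ?_ (fun j => ?_) j
  · rw [h.x0x, sub_self]
    exact zero_mem _
  rw [h.xx, add_sub_cancel_left]
  exact Submodule.smul_mem _ _ (x_mem_filtration 0)

theorem commutator_x_X (i : Fin (r + 1)) (m : Fin d) :
    x A b i * X A b m - X A b m * x A b i ∈ filtration A b 2 := by
  have h := isUMFamily A b
  refine Fin.cases ?_ (fun i => ?_) i
  · rw [h.x0X, sub_self]
    exact zero_mem _
  rw [h.xM, add_sub_cancel_left]
  exact Submodule.sum_mem _ fun l _ => Submodule.smul_mem _ _ (x_mem_filtration _)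

theorem commutator_x_y (i : Fin (r + 1)) (j : Fin r) :
    x A b i * y A b j - y A b j * x A b i = 0 := by
  have h := isUMFamily A b
  refine Fin.cases ?_ (fun i => ?_) i
  · rw [h.x0y, sub_self]
  · rw [h.xy, sub_self]

theorem commutator_X_X (m n : Fin d) :
    X A b m * X A b n - X A b n * X A b m ∈ filtration A b 2 := by
  rw [(isUMFamily A b).MN, add_sub_cancel_left]
  exact Submodule.sum_mem _ fun l _ => Submodule.smul_mem _ _ (X_mem_filtration _)

theorem commutator_y_X (i : Fin r) (m : Fin d) :
    y A b i * X A b m - X A b m * y A b i ∈ filtration A b 3 := by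
  rw [(isUMFamily A b).yM, add_sub_cancel_left]
  exact Submodule.sum_mem _ fun l _ => Submodule.smul_mem _ _ (y_mem_filtration _)

theorem commutator_y_y (i j : Fin r) :
    y A b i * y A b j - y A b j * y A b i ∈ filtration A b 4 := by
  have h0 : x A b 0 ∈ filtration A b 2 := x_mem_filtration 0
  have h2 : x A b 0 ^ 2 ∈ filtration A b 3 := by
    rw [pow_two]
    exact mul_mem_wordFiltration (by norm_num) h0 h0
  have h3 : x A b 0 ^ 3 ∈ filtration A b 4 := by
    rw [pow_succ]
    exact mul_mem_wordFiltration (by norm_num) h2 h0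
  rw [(isUMFamily A b).yy, add_sub_cancel_left]
  exact Submodule.smul_mem _ _ h3

variable (A b) in
/-- The commutator of two generators has smaller weight than their product. -/
theorem commutator_mem_filtration (i j : Fin (r + 1 + d + r)) :
    gens A b i * gens A b j - gens A b j * gens A b i ∈
      filtration A b (genWeight r d i + genWeight r d j) := by
  induction i using Fin.addCases with
  | left i =>
    induction i using Fin.addCases with
    | left i =>
      induction j using Fin.addCases with
      | left j =>
        induction j using Fin.addCases with
        | left j =>
          rw [gens_x, gens_x, genWeight_x, genWeight_x]
          exact commutator_x_x i j
        | right j =>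
          rw [gens_x, gens_X, genWeight_x, genWeight_X]
          exact commutator_x_X i j
      | right j =>
        rw [gens_x, gens_y, commutator_x_y]
        exact zero_mem _
    | right i =>
      induction j using Fin.addCases with
      | left j =>
        induction j using Fin.addCases with
        | left j =>
          rw [gens_x, gens_X, genWeight_x, genWeight_X, ← neg_sub]
          exact neg_mem (commutator_x_X j i)
        | right j =>
          rw [gens_X, gens_X, genWeight_X, genWeight_X]
          exact commutator_X_X i j
      | right j =>
        rw [gens_X, gens_y, genWeight_X, genWeight_y, ← neg_sub]
        exact neg_mem (commutator_y_X j i)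
  | right i =>
    induction j using Fin.addCases with
    | left j =>
      induction j using Fin.addCases with
      | left j =>
        rw [gens_x, gens_y, ← neg_sub, commutator_x_y, neg_zero]
        exact zero_mem _
      | right j =>
        rw [gens_X, gens_y, genWeight_X, genWeight_y]
        exact commutator_y_X i j
    | right j =>
      rw [gens_y, gens_y, genWeight_y, genWeight_y]
      exact commutator_y_y i j

/-- The Hopf algebra `UM(A)` is connected. -/
theorem isConnectedHopf [CharZero k] (hA : A.transpose = -A) :
    letI := hopfAlgebra b hA; IsConnectedHopf k (UM A b) := by
  let := hopfAlgebra b hA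
  refine isConnectedHopf_of_weight (w := genWeight r d) (adjoin_gens A b) fun i => ?_
  change comulHom A b _ - _ ∈ _
  have h1 : (1 : UM A b) ∈ filtration A b 1 := one_mem_wordFiltration one_pos
  induction i using Fin.addCases with
  | left i =>
    induction i using Fin.addCases with
    | left i =>
      rw [gens_x, genWeight_x, comulHom_x, add_sub_cancel_right]
      exact tmul_mem_tensorFiltration _ h1
    | right i =>
      rw [gens_X, genWeight_X, comulHom_X, add_sub_cancel_right]
      exact tmul_mem_tensorFiltration _ h1
  | right i =>
    rw [gens_y, genWeight_y, comulHom_y, show ∀ p q s t : UM A b ⊗[k] UM A b,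
      p + q + s - t - q = p + s - t from fun p q s t => by abel]
    exact sub_mem (add_mem (tmul_mem_tensorFiltration _ (wordFiltration_mono one_le_two h1))
      (tmul_mem_tensorFiltration _ (x_mem_filtration _)))
      (tmul_mem_tensorFiltration _ (x_mem_filtration _))

end Weights

end UM

theorem mainTheorem3 {k : Type*} [Field k] [CharZero k] {r d : ℕ}
    (A : Matrix (Fin r) (Fin r) k) (hA : A.transpose = -A)
    (b : Module.Basis (Fin d) k (soLie A)) :
    (∃ H : HopfAlgebra k (UM A b),
        H.toAlgebra = UM.instAlgebra A b ∧
        (∀ i : Fin (r + 1), IsPrimitiveElt k (UM.x A b i)) ∧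
        (∀ M : soLie A, IsPrimitiveElt k (UM.ofSo A b M)) ∧
        (∀ i : Fin r, IsWedgeElt k (UM.x A b 0) (UM.x A b i.succ) (UM.y A b i)) ∧
        IsConnectedHopf k (UM A b)) ∧
      IsPBWGeneratingSet k (UM.gens A b) ∧
      GKdim k (UM A b) = ((2 * r + 1 + Module.finrank k (soLie A) : ℕ) : EReal) :=
  ⟨⟨UM.hopfAlgebra b hA, UM.hopfAlgebra_toAlgebra hA, UM.isPrimitiveElt_x hA,
      UM.isPrimitiveElt_ofSo hA, UM.isWedgeElt_y hA, UM.isConnectedHopf hA⟩,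
    ⟨UM.linearIndependent_orderedMonomial b hA, span_orderedMonomial_eq_top (UM.adjoin_gens A b)
      (UM.commutator_mem_filtration A b)⟩, by
    rw [GKdim_eq (UM.adjoin_gens A b) UM.one_le_genWeight (UM.commutator_mem_filtration A b)
      (UM.linearIndependent_orderedMonomial b hA), Module.finrank_eq_card_basis b, Fintype.card_fin,
      show r + 1 + d + r = 2 * r + 1 + d by omega]⟩
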